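/- Let $N\ge 2$ be an integer, $s\in(0,1)$, $m>0$, $2^*_s:=\frac{2N}{N-2s}$, and let $g\colon\mathbb R\to\mathbb R$ satisfy - (g0) $g$ is continuous and $g(0)=0$; - (g1) $\limsup_{t\to0}\frac{g(t)}{t}\le 0$ (the upper limit is taken in $[-\infty,+\infty]$); - (g2) $\limsup_{|t|\to+\infty}\frac{|g(t)|}{|t|^{2^*_s-1}}<\infty$. Set $G(t):=\int_0^t g(\tau)\,d\tau$. Let $H^s(\mathbb R^N)$ be the space of real-valued $u\in L^2(\mathbb R^N)$ with $|\cdot|^s\mathcal F(u)\in L^2(\mathbb R^N)$, where $\mathcal F$ is the Fourier transform, and let $(-\Delta)^{s/2}u:=\mathcal F^{-1}\big(|\xi|^s\mathcal F(u)\big)$, with the frequency normalization $\mathcal F u(\xi)=c\int_{\mathbb R^N} e^{-i x\cdot\xi}u(x)\,dx$. For $u\in H^s(\mathbb R^N)$ the integral $\int_{\mathbb R^N}G(u)\,dx$ is understood in $[-\infty,+\infty)$. For $\mu\in\mathbb R$ and $u\in H^s(\mathbb R^N)$ define, with values in $(-\infty,+\infty]$, $$K(u):=\frac12\int_{\mathbb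 R^N}|(-\Delta)^{s/2}u|^2\,dx-\int_{\mathbb R^N}G(u)\,dx,$$ $$I^m(\mu,u):=\frac12\int_{\mathbb R^N}|(-\Delta)^{s/2}u|^2\,dx+\frac\mu2\Big(\int_{\mathbb R^N}u^2\,dx-m\Big)-\int_{\mathbb R^N}G(u)\,dx,$$ $$P(\mu,u):=\int_{\mathbb R^N}|(-\Delta)^{s/2}u|^2\,dx+2^*_s\Big(\frac\mu2\int_{\mathbb R^N}u^2\,dx-\int_{\mathbb R^N}G(u)\,dx\Big).$$ Let $\mathcal S_m:=\{u\in H^s(\mathbb R^N) : \int_{\mathbb R^N}u^2\,dx=m\}$ and, for $\rho\in[-\infty,+\infty)$, $$\mathcal P_{(\rho)}:=\{(\mu,u)\in(\rho,+\infty)\times H^s(\mathbb R^N) : u\neq0,\ P(\mu,u)=0\}.$$ **Proposition 1.6 (Pohožaev minima are solutions).** Let $\rho\in[-\infty,+\infty)$ and let $(\mu,u)\in\mathcal P_{(\rho)}$ satisfy $I^m(\mu,u)=\min_{\mathcal P_{(\rho)}}I^m$. Then $u\in\mathcal S_m$, and $u$ is a weak solution of $(-\Delta)^su+\mu u=g(u)$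 in $\mathbb R^N$: for every $\varphi\in H^s(\mathbb R^N)\cap L^1(\mathbb R^N)$ the function $g(u)\varphi$ is integrable and $$\int_{\mathbb R^N}(-\Delta)^{s/2}u\,(-\Delta)^{s/2}\varphi\,dx+\mu\int_{\mathbb R^N}u\varphi\,dx=\int_{\mathbb R^N}g(u)\varphi\,dx.$$ Moreover, if $\min_{\mathcal P_{(\rho)}}I^m<-\frac\rho2m$ (no condition when $\rho=-\infty$), then $I^m(\mu,u)=K(u)=\inf_{\mathcal S_m}K$. -/

import Mathlib

open MeasureTheory Filter Topology
open scoped FourierTransform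

noncomputable section

namespace NormalizedSol

/-- `ℝ^N` with its Euclidean norm and Lebesgue measure. -/
abbrev RN (N : ℕ) : Type := EuclideanSpace ℝ (Fin N)

/-- The real Hilbert space `L²(ℝ^N)` (classes of real-valued functions modulo a.e. equality). -/
abbrev L2 (N : ℕ) : Type := Lp (α := RN N) ℝ 2 volume

/-- The Fourier transform `𝓕 u ∈ L²(ℝ^N; ℂ)` of a real-valued `u ∈ L²(ℝ^N)`, in the normalization
`𝓕 u ξ = ∫ exp (-2πi x·ξ) u x dx`. -/
def fourierL2 (N : ℕ) (u : L2 N) : Lp (α := RN N) ℂ 2 volume :=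
  𝓕 (Complex.ofRealCLM.compLp u)

/-- The function `ξ ↦ (2π|ξ|)^s 𝓕 u (ξ)`. With the frequency normalization of `fourierL2`,
the Fourier symbol of `(-Δ)^(s/2)` is `(2π|ξ|)^s`. -/
def halfSymbolMul (N : ℕ) (s : ℝ) (u : L2 N) : RN N → ℂ :=
  fun ξ => (((2 * Real.pi * ‖ξ‖) ^ s : ℝ) : ℂ) * fourierL2 N u ξ

theorem fourierL2_add (N : ℕ) (u v : L2 N) :
    fourierL2 N (u + v) = fourierL2 N u + fourierL2 N v := by
  have h : Complex.ofRealCLM.compLp (u + v)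
      = Complex.ofRealCLM.compLp u + Complex.ofRealCLM.compLp v :=
    (Complex.ofRealCLM.compLpₗ (p := 2) (μ := (volume : Measure (RN N)))).map_add u v
  unfold fourierL2
  rw [h]
  exact (Lp.fourierTransformₗᵢ (RN N) ℂ).map_add _ _

theorem fourierL2_smul (N : ℕ) (c : ℝ) (u : L2 N) :
    fourierL2 N (c • u) = (c : ℂ) • fourierL2 N u := by
  have h : Complex.ofRealCLM.compLp (c • u) = (c : ℂ) • Complex.ofRealCLM.compLp u := by
    refine ((Complex.ofRealCLM.compLpₗ (p := 2) (μ := (volume : Measure (RN N)))).map_smul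
      c u).trans ?_
    refine Lp.ext ?_
    filter_upwards [Lp.coeFn_smul c (Complex.ofRealCLM.compLp u),
      Lp.coeFn_smul (c : ℂ) (Complex.ofRealCLM.compLp u)] with x h1 h2
    simp only [ContinuousLinearMap.compLpₗ_apply]
    rw [h1, h2]
    simp
  unfold fourierL2
  rw [h]
  exact (Lp.fourierTransformₗᵢ (RN N) ℂ).map_smul _ _

/-- The fractional Sobolev space `H^s(ℝ^N) = {u ∈ L² : |·|^s 𝓕 u ∈ L²}`. -/
def Hs (N : ℕ) (s : ℝ) : Submodule ℝ (L2 N) where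
  carrier := {u | MemLp (halfSymbolMul N s u) 2 volume}
  zero_mem' := by
    have h0 : fourierL2 N 0 = 0 := by
      simpa using fourierL2_smul N 0 0
    refine (memLp_congr_ae ?_).2 (MemLp.zero (p := 2) (ε := ℂ) (μ := (volume : Measure (RN N))))
    filter_upwards with x
    simp [halfSymbolMul, h0]
  add_mem' := by
    intro u v hu hv
    refine (memLp_congr_ae ?_).2 (MemLp.add hu hv)
    filter_upwards [Lp.coeFn_add (fourierL2 N u) (fourierL2 N v)] with x hx
    have hx' : fourierL2 N (u + v) x = fourierL2 N u x + fourierL2 N v x := by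
      rw [fourierL2_add, hx, Pi.add_apply]
    simp only [halfSymbolMul, hx', Pi.add_apply]
    ring
  smul_mem' := by
    intro c u hu
    refine (memLp_congr_ae ?_).2 (MemLp.const_smul hu (c : ℂ))
    filter_upwards [Lp.coeFn_smul (c : ℂ) (fourierL2 N u)] with x hx
    have hx' : fourierL2 N (c • u) x = (c : ℂ) * fourierL2 N u x := by
      rw [fourierL2_smul, hx, Pi.smul_apply, smul_eq_mul]
    simp only [halfSymbolMul, hx', Pi.smul_apply, smul_eq_mul]
    ring

theorem memLp_of_Hs {N : ℕ} {s : ℝ} (u : Hs N s) :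
    MemLp (halfSymbolMul N s (u : L2 N)) 2 volume :=
  u.2

/-- `(-Δ)^(s/2) u = 𝓕⁻¹ ((2π|ξ|)^s 𝓕 u) ∈ L²(ℝ^N)` for `u ∈ H^s(ℝ^N)`. The inverse Fourier
transform is real-valued a.e. because `u` is real and the symbol is real and even, so that taking
the real part only turns a complex-valued class into the same real-valued class. -/
def halfLap {N : ℕ} {s : ℝ} (u : Hs N s) : L2 N :=
  Complex.reCLM.compLp
    (𝓕⁻ ((memLp_of_Hs u).toLp (halfSymbolMul N s (u : L2 N))) : Lp (α := RN N) ℂ 2 volume)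

/-- `∫ |(-Δ)^(s/2) u|² dx`. -/
def gradSq {N : ℕ} {s : ℝ} (u : Hs N s) : ℝ :=
  ∫ x, (halfLap u x) ^ 2

/-- The mass `|u|₂² = ∫ u² dx`. -/
def mass {N : ℕ} {s : ℝ} (u : Hs N s) : ℝ :=
  ∫ x, ((u : L2 N) x) ^ 2

/-- The primitive `G(t) = ∫₀ᵗ g(τ) dτ`. -/
def primitive (g : ℝ → ℝ) (t : ℝ) : ℝ :=
  ∫ τ in (0 : ℝ)..t, g τ

/-- The extended integral `∫ f⁺ dx - ∫ f⁻ dx`; it equals `-∞` when `∫ f⁻ dx = ∞`. -/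
def extIntegral {N : ℕ} (f : RN N → ℝ) : EReal :=
  ((∫⁻ x, ENNReal.ofReal (f x) : ENNReal) : EReal)
    - ((∫⁻ x, ENNReal.ofReal (-f x) : ENNReal) : EReal)

/-- `∫ G(u) dx ∈ [-∞, ∞)`. -/
def potential {N : ℕ} {s : ℝ} (g : ℝ → ℝ) (u : Hs N s) : EReal :=
  extIntegral fun x => primitive g ((u : L2 N) x)

/-- The fractional Sobolev critical exponent `2*_s = 2N/(N-2s)`. -/
def critExp (N : ℕ) (s : ℝ) : ℝ :=
  2 * N / (N - 2 * s)

/-- (g0): `g` is continuous and `g 0 = 0`. -/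
def G0 (g : ℝ → ℝ) : Prop :=
  Continuous g ∧ g 0 = 0

/-- (g1): `limsup_{t → 0} g(t)/t ≤ 0`, the upper limit being taken in `[-∞, ∞]`. -/
def G1 (g : ℝ → ℝ) : Prop :=
  limsup (fun t : ℝ => ((g t / t : ℝ) : EReal)) (𝓝[≠] 0) ≤ 0

/-- (g2): `limsup_{|t| → ∞} |g(t)| / |t|^(2*_s - 1) < ∞`. -/
def G2 (N : ℕ) (s : ℝ) (g : ℝ → ℝ) : Prop :=
  limsup (fun t : ℝ => ((|g t| / |t| ^ (critExp N s - 1) : ℝ) : EReal)) (cocompact ℝ) < ⊤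

/-- The energy `K(u) = ½ ∫ |(-Δ)^(s/2) u|² - ∫ G(u) ∈ (-∞, ∞]`. -/
def energy {N : ℕ} {s : ℝ} (g : ℝ → ℝ) (u : Hs N s) : EReal :=
  ((1 / 2 * gradSq u : ℝ) : EReal) - potential g u

/-- The Lagrangian `I^m(μ, u) = ½ ∫ |(-Δ)^(s/2) u|² + (μ/2)(∫ u² - m) - ∫ G(u)`. -/
def lagrangian {N : ℕ} {s : ℝ} (g : ℝ → ℝ) (m : ℝ) (p : ℝ × Hs N s) : EReal :=
  ((1 / 2 * gradSq p.2 + p.1 / 2 * (mass p.2 - m) : ℝ) : EReal) - potential g p.2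

/-- The Pohožaev functional `P(μ, u) = ∫ |(-Δ)^(s/2) u|² + 2*_s (∫ (μ/2) u² - ∫ G(u))`. -/
def pohozaev {N : ℕ} {s : ℝ} (g : ℝ → ℝ) (p : ℝ × Hs N s) : EReal :=
  ((gradSq p.2 : ℝ) : EReal)
    + ((critExp N s : ℝ) : EReal) * (((p.1 / 2 * mass p.2 : ℝ) : EReal) - potential g p.2)

/-- The `L²`-sphere `S_m = {u ∈ H^s : |u|₂² = m}`. -/
def sphere (N : ℕ) (s m : ℝ) : Set (Hs N s) :=
  {u | mass u = m}

/-- `P_(ρ) = {(μ, u) ∈ (ρ, ∞) × H^s : u ≠ 0, P(μ, u) = 0}`, for `ρ ∈ [-∞, ∞]`. -/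
def pohozaevSet (N : ℕ) (s : ℝ) (g : ℝ → ℝ) (ρ : EReal) : Set (ℝ × Hs N s) :=
  {p | ρ < (p.1 : EReal) ∧ p.2 ≠ 0 ∧ pohozaev g p = 0}

/-- `u` is a weak solution of `(-Δ)^s u + μ u = g(u)` in `ℝ^N`: for each
`φ ∈ H^s(ℝ^N) ∩ L¹(ℝ^N)`, the product `g(u) φ` is integrable and
`∫ (-Δ)^(s/2) u (-Δ)^(s/2) φ + μ ∫ u φ = ∫ g(u) φ`.
(The two integrands on the left are products of `L²` functions.) -/
def IsWeakSolution {N : ℕ} {s : ℝ} (g : ℝ → ℝ) (μ : ℝ) (u : Hs N s) : Prop :=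
  ∀ φ : Hs N s, Integrable (fun x => (φ : L2 N) x) →
    Integrable (fun x => g ((u : L2 N) x) * (φ : L2 N) x) ∧
    (∫ x, halfLap u x * halfLap φ x) + μ * (∫ x, (u : L2 N) x * (φ : L2 N) x)
      = ∫ x, g ((u : L2 N) x) * (φ : L2 N) x

end NormalizedSol

end

/-! The Pohožaev set is a natural constraint: minimizing on it produces no Lagrange multiplier.
Write `a = ∫ |(-Δ)^(s/2) v|²` and `b = ∫ G(v) - (μ/2) ∫ v²`. Under `v ↦ v(R·)` the first scales by
`R^(2s-N)` and the second by `R^(-N)`, so when `a, b > 0` the choice `R^(2s) = 2*_s b / a` lands on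
the set, and the action there is `fiberMax N s a b - μ m / 2` (`exists_dilate_mem_pohozaevSet`).
Along any differentiable path through the minimizer this is a real function with a local minimum. On
the set `a = 2*_s b`, and there the derivative of `fiberMax` is `a'/2 - b'` (`hasDerivAt_fiberMax`).
Hence the free derivative of the Lagrangian vanishes along the path (`deriv_eq_zero_of_isMinOn`).

Varying `μ` alone gives mass `m`; varying `u` in a direction `φ ∈ H^s ∩ L¹` gives the weak equation.
No differentiable structure on the set is needed, and `G(u)` may fail to be integrable for general
`u`: membership in the Pohožaev set forces integrability, and `φ ∈ L¹` preserves it under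
perturbation (`hasDerivAt_potential`). The growth estimates rest on the embedding `H^s ⊂ L^{2*_s}`
(`integrable_rpow_critExp`).

For the last claim, each `v ∈ S_m` with `G(v)` integrable satisfies `P(ν, v) = 0` for exactly one
`ν`, and `I^m(ν, v) = K(v)`. If `ν > ρ`, minimality bounds `K(v)` below. If `ν ≤ ρ`, then `K(v) =
(s/N) a - ν m / 2 ≥ -ρ m / 2`, which exceeds the minimum. -/

noncomputable section

namespace NormalizedSol

open scoped ComplexConjugate SchwartzMap

/-! ### Duality, dilation and conjugation for the `L²` Fourier transform -/

section Fourier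

variable {N : ℕ}

/-- The `L²` transform has no pointwise formula, so identities for it are obtained by moving `𝓕`
onto a Schwartz test function. -/
theorem integral_schwartz_mul_fourier (w : Lp (α := RN N) ℂ 2 volume) (g : 𝓢(RN N, ℂ)) :
    ∫ ξ, g ξ * (𝓕 w : Lp (α := RN N) ℂ 2 volume) ξ = ∫ x, (𝓕 g) x * w x := by
  have h := congrArg (fun T => T g) (Lp.fourier_toTemperedDistribution_eq w)
  simpa [TemperedDistribution.fourier_apply] using h.symm

theorem integral_schwartz_mul_fourierInv (w : Lp (α := RN N) ℂ 2 volume) (g : 𝓢(RN N, ℂ)) :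
    ∫ ξ, g ξ * (𝓕⁻ w : Lp (α := RN N) ℂ 2 volume) ξ = ∫ x, (𝓕⁻ g) x * w x := by
  have h := congrArg (fun T => T g) (Lp.fourierInv_toTemperedDistribution_eq w)
  simpa [TemperedDistribution.fourierInv_apply] using h.symm

/-- Two `L²` functions with the same pairings against Schwartz functions agree. -/
theorem Lp_eq_of_integral_schwartz {v w : Lp (α := RN N) ℂ 2 volume}
    (h : ∀ g : 𝓢(RN N, ℂ), ∫ x, g x * v x = ∫ x, g x * w x) : v = w := by
  have hk := Lp.ker_toTemperedDistributionCLM_eq_bot (E := RN N) (F := ℂ) (μ := volume) (p := 2)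
  refine LinearMap.ker_eq_bot.1 hk ?_
  ext g
  simpa using h g

theorem eq_fourier_of_integral_schwartz {h w : Lp (α := RN N) ℂ 2 volume}
    (H : ∀ g : 𝓢(RN N, ℂ), ∫ ξ, g ξ * h ξ = ∫ x, (𝓕 g) x * w x) : h = 𝓕 w :=
  Lp_eq_of_integral_schwartz fun g => by rw [H, integral_schwartz_mul_fourier]

/-- On `L¹ ∩ L²` the inverse Fourier transform is given by the integral formula. -/
theorem fourierInv_ae_eq_of_integrable (w : Lp (α := RN N) ℂ 2 volume)
    (hw : Integrable (w : RN N → ℂ)) :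
    (𝓕⁻ w : Lp (α := RN N) ℂ 2 volume) =ᵐ[volume] 𝓕⁻ (w : RN N → ℂ) := by
  have hcont : Continuous (𝓕⁻ (w : RN N → ℂ)) :=
    VectorFourier.fourierIntegral_continuous Real.continuous_fourierChar
      (L := -innerₗ (RN N)) (by simp only [LinearMap.neg_apply, innerₗ_apply_apply]; fun_prop) hw
  refine ae_eq_of_integral_contDiff_smul_eq ((Lp.memLp _).locallyIntegrable (by norm_num))
    hcont.locallyIntegrable fun g hg hgc => ?_
  have hg₁ : HasCompactSupport (Complex.ofRealCLM ∘ g) := hgc.comp_left rfl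
  have hg₂ : ContDiff ℝ (⊤ : ℕ∞) (Complex.ofRealCLM ∘ g) := by fun_prop
  have h1 := integral_schwartz_mul_fourierInv w (hg₁.toSchwartzMap hg₂)
  have h2 := VectorFourier.integral_fourierIntegral_smul_eq_flip
    (L := -innerₗ (RN N)) (μ := volume) (ν := volume) (f := hg₁.toSchwartzMap hg₂) (g := w)
    Real.continuous_fourierChar
    (by simp only [LinearMap.neg_apply, innerₗ_apply_apply]; fun_prop)
    (hg₁.toSchwartzMap hg₂).integrable hw
  -- The multiplication formula returns the transform for the flipped form; symmetry of the inner
  -- product makes it the same transform.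
  have hflip : (-innerₗ (RN N)).flip = -innerₗ (RN N) := by
    ext x y
    simp [real_inner_comm]
  rw [hflip] at h2
  rw [SchwartzMap.fourierInv_coe] at h1
  have h3 := h1.trans h2
  simp only [Complex.real_smul]
  exact h3

theorem norm_fourierInv_le_of_integrable (w : Lp (α := RN N) ℂ 2 volume)
    (hw : Integrable (w : RN N → ℂ)) :
    ∀ᵐ x, ‖(𝓕⁻ w : Lp (α := RN N) ℂ 2 volume) x‖ ≤ ∫ ξ, ‖w ξ‖ := by
  filter_upwards [fourierInv_ae_eq_of_integrable w hw] with x hx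
  rw [hx]
  exact VectorFourier.norm_fourierIntegral_le_integral_norm _ _ _ _ _

theorem quasiMeasurePreserving_smul_RN {R : ℝ} (hR : R ≠ 0) :
    Measure.QuasiMeasurePreserving (fun x : RN N => R • x) volume volume :=
  Measure.quasiMeasurePreserving_smul volume hR

theorem memLp_two_comp_smul {E : Type*} [NormedAddCommGroup E] {f : RN N → E}
    (hf : MemLp f 2 volume) {R : ℝ} (hR : R ≠ 0) :
    MemLp (fun x => f (R • x)) 2 volume := by
  have hm : AEStronglyMeasurable (fun x => f (R • x)) volume :=
    hf.1.comp_quasiMeasurePreserving (quasiMeasurePreserving_smul_RN hR)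
  rw [memLp_two_iff_integrable_sq_norm hm]
  exact ((integrable_comp_smul_iff volume (fun x => ‖f x‖ ^ 2) hR)).2
    ((memLp_two_iff_integrable_sq_norm hf.1).1 hf)

/-- The `L²` class of `x ↦ f (R x)`. -/
def dilate {E : Type*} [NormedAddCommGroup E] {R : ℝ} (hR : R ≠ 0)
    (f : Lp (α := RN N) E 2 volume) : Lp (α := RN N) E 2 volume :=
  (memLp_two_comp_smul (Lp.memLp f) hR).toLp _

theorem coeFn_dilate {E : Type*} [NormedAddCommGroup E] {R : ℝ} (hR : R ≠ 0)
    (f : Lp (α := RN N) E 2 volume) : dilate hR f =ᵐ[volume] fun x => f (R • x) :=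
  MemLp.coeFn_toLp _

theorem integral_comp_smul_RN {E : Type*} [NormedAddCommGroup E] [NormedSpace ℝ E]
    (f : RN N → E) {R : ℝ} (hR : 0 < R) :
    ∫ x, f (R • x) = (R ^ N)⁻¹ • ∫ x, f x := by
  rw [Measure.integral_comp_smul_of_nonneg volume f R (hR := hR.le)]
  simp

/-- The dilation of a Schwartz function. -/
def schwartzDilate {R : ℝ} (hR : R ≠ 0) (g : 𝓢(RN N, ℂ)) : 𝓢(RN N, ℂ) :=
  SchwartzMap.compCLMOfContinuousLinearEquiv ℂ
    (ContinuousLinearEquiv.smulLeft (M₁ := RN N) (R₁ := ℝ) (Units.mk0 R hR)) g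

theorem schwartzDilate_apply {R : ℝ} (hR : R ≠ 0) (g : 𝓢(RN N, ℂ)) (x : RN N) :
    schwartzDilate hR g x = g (R • x) := rfl

theorem fourier_schwartzDilate {R : ℝ} (hR : 0 < R) (g : 𝓢(RN N, ℂ)) (ξ : RN N) :
    (𝓕 (schwartzDilate hR.ne' g)) ξ = ((R ^ N)⁻¹ : ℝ) • (𝓕 g) (R⁻¹ • ξ) := by
  rw [SchwartzMap.fourier_coe, SchwartzMap.fourier_coe, Real.fourier_eq, Real.fourier_eq,
    ← integral_comp_smul_RN _ hR]
  refine integral_congr_ae (Eventually.of_forall fun x => ?_)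
  simp only [schwartzDilate_apply, inner_smul_left, inner_smul_right]
  congr 3
  simp [hR.ne']

theorem fourier_dilate {R : ℝ} (hR : 0 < R) (w : Lp (α := RN N) ℂ 2 volume) :
    (𝓕 (dilate hR.ne' w) : Lp (α := RN N) ℂ 2 volume)
      = (((R ^ N)⁻¹ : ℝ) : ℂ) • dilate (inv_ne_zero hR.ne') (𝓕 w) := by
  symm
  refine eq_fourier_of_integral_schwartz fun g => ?_
  have h1 : ∫ ξ, g ξ * ((((R ^ N)⁻¹ : ℝ) : ℂ) • dilate (inv_ne_zero hR.ne') (𝓕 w) :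
        Lp (α := RN N) ℂ 2 volume) ξ
      = ∫ ξ, (((R ^ N)⁻¹ : ℝ) : ℂ) *
          (schwartzDilate hR.ne' g (R⁻¹ • ξ) * (𝓕 w : Lp (α := RN N) ℂ 2 volume) (R⁻¹ • ξ)) := by
    refine integral_congr_ae ?_
    filter_upwards [Lp.coeFn_smul (((R ^ N)⁻¹ : ℝ) : ℂ) (dilate (inv_ne_zero hR.ne') (𝓕 w)),
      coeFn_dilate (inv_ne_zero hR.ne') (𝓕 w)] with ξ h1 h2
    rw [h1, Pi.smul_apply, h2, schwartzDilate_apply, smul_smul, mul_inv_cancel₀ hR.ne', one_smul,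
      smul_eq_mul]
    ring
  have h2 : ∫ x, (𝓕 g) x * dilate hR.ne' w x
      = ∫ x, (R ^ N : ℝ) • ((𝓕 (schwartzDilate hR.ne' g)) (R • x) * w (R • x)) := by
    refine integral_congr_ae ?_
    filter_upwards [coeFn_dilate hR.ne' w] with x hx
    rw [hx, fourier_schwartzDilate hR, smul_smul, inv_mul_cancel₀ hR.ne', one_smul,
      smul_mul_assoc, smul_smul, mul_inv_cancel₀ (by positivity), one_smul]
  have h3 : ∫ x, (𝓕 (schwartzDilate hR.ne' g)) (R • x) * w (R • x)
      = (R ^ N)⁻¹ • ∫ x, (𝓕 (schwartzDilate hR.ne' g)) x * w x :=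
    integral_comp_smul_RN (fun x => (𝓕 (schwartzDilate hR.ne' g)) x * w x) hR
  have h4 : ∫ x, schwartzDilate hR.ne' g (R⁻¹ • x) *
        (𝓕 w : Lp (α := RN N) ℂ 2 volume) (R⁻¹ • x)
      = (R⁻¹ ^ N)⁻¹ • ∫ x, schwartzDilate hR.ne' g x * (𝓕 w : Lp (α := RN N) ℂ 2 volume) x :=
    integral_comp_smul_RN (fun x => schwartzDilate hR.ne' g x *
      (𝓕 w : Lp (α := RN N) ℂ 2 volume) x) (inv_pos.2 hR)
  rw [h1, h2, integral_smul, integral_const_mul, h3, h4, integral_schwartz_mul_fourier]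
  have hRN : (R : ℂ) ^ N ≠ 0 := pow_ne_zero _ (by exact_mod_cast hR.ne')
  simp [hRN]

/-- `g ↦ conj (g (-·))` on Schwartz functions. -/
def schwartzConjNeg (g : 𝓢(RN N, ℂ)) : 𝓢(RN N, ℂ) :=
  SchwartzMap.postcompCLM (𝕜 := ℝ) (Complex.conjCLE : ℂ →L[ℝ] ℂ)
    (schwartzDilate (by norm_num : (-1 : ℝ) ≠ 0) g)

theorem schwartzConjNeg_apply (g : 𝓢(RN N, ℂ)) (x : RN N) :
    schwartzConjNeg g x = conj (g (-x)) := by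
  simp [schwartzConjNeg, schwartzDilate_apply]

theorem fourier_schwartzConjNeg (g : 𝓢(RN N, ℂ)) (ξ : RN N) :
    (𝓕 (schwartzConjNeg g)) ξ = conj ((𝓕 g) ξ) := by
  rw [SchwartzMap.fourier_coe, SchwartzMap.fourier_coe, Real.fourier_eq', Real.fourier_eq',
    ← integral_conj, ← integral_neg_eq_self]
  refine integral_congr_ae (Eventually.of_forall fun x => ?_)
  simp [schwartzConjNeg_apply, ← Complex.exp_conj, Complex.conj_ofNat]

/-- The class of `conj ∘ w` for `w ∈ L²`. -/
def conjL2 (w : Lp (α := RN N) ℂ 2 volume) : Lp (α := RN N) ℂ 2 volume :=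
  (Complex.conjCLE : ℂ →L[ℝ] ℂ).compLp w

theorem coeFn_conjL2 (w : Lp (α := RN N) ℂ 2 volume) :
    conjL2 w =ᵐ[volume] fun x => conj (w x) := by
  filter_upwards [(Complex.conjCLE : ℂ →L[ℝ] ℂ).coeFn_compLp w] with x hx
  simpa [conjL2] using hx

/-- Obtained by duality from `fourier_schwartzConjNeg`. It turns real-valuedness into Hermitian
symmetry on the frequency side. -/
theorem fourier_conjL2 (w : Lp (α := RN N) ℂ 2 volume) :
    (𝓕 (conjL2 w) : Lp (α := RN N) ℂ 2 volume)
      = conjL2 (dilate (by norm_num : (-1 : ℝ) ≠ 0) (𝓕 w)) := by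
  symm
  refine eq_fourier_of_integral_schwartz fun g => ?_
  have h1 : ∫ ξ, g ξ * conjL2 (dilate (by norm_num : (-1 : ℝ) ≠ 0) (𝓕 w)) ξ
      = conj (∫ ξ, schwartzConjNeg g ξ * (𝓕 w : Lp (α := RN N) ℂ 2 volume) ξ) := by
    rw [← integral_conj, ← integral_neg_eq_self]
    have hq : Measure.QuasiMeasurePreserving (fun x : RN N => -x) volume volume :=
      (Measure.measurePreserving_neg volume).quasiMeasurePreserving
    refine integral_congr_ae ?_
    filter_upwards [hq.ae (coeFn_conjL2 (dilate (by norm_num : (-1 : ℝ) ≠ 0) (𝓕 w))),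
      hq.ae (coeFn_dilate (by norm_num : (-1 : ℝ) ≠ 0) (𝓕 w))] with x hx1 hx2
    rw [hx1, hx2]
    simp [schwartzConjNeg_apply]
  have h2 : ∫ x, (𝓕 g) x * conjL2 w x = conj (∫ x, (𝓕 (schwartzConjNeg g)) x * w x) := by
    rw [← integral_conj]
    refine integral_congr_ae ?_
    filter_upwards [coeFn_conjL2 w] with x hx
    rw [hx, fourier_schwartzConjNeg]
    simp
  rw [h1, h2, integral_schwartz_mul_fourier]

end Fourier

/-! ### Reality, Plancherel and quadratic expansion for the half Laplacian -/

section HalfLaplacian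

variable {N : ℕ} {s : ℝ}

theorem coeFn_ofReal_compLp (f : L2 N) :
    (Complex.ofRealCLM.compLp f : Lp (α := RN N) ℂ 2 volume) =ᵐ[volume] fun x => (f x : ℂ) := by
  filter_upwards [Complex.ofRealCLM.coeFn_compLp f] with x hx
  simpa using hx

theorem conjL2_ofReal (f : L2 N) :
    conjL2 (Complex.ofRealCLM.compLp f) = Complex.ofRealCLM.compLp f := by
  refine Lp.ext ?_
  filter_upwards [coeFn_conjL2 (Complex.ofRealCLM.compLp f), coeFn_ofReal_compLp f] with x h1 h2
  rw [h1, h2, Complex.conj_ofReal]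

/-- A class fixed by conjugation is real-valued. -/
theorem ofReal_re_compLp {w : Lp (α := RN N) ℂ 2 volume} (h : conjL2 w = w) :
    Complex.ofRealCLM.compLp (Complex.reCLM.compLp w : L2 N) = w := by
  refine Lp.ext ?_
  filter_upwards [coeFn_ofReal_compLp (Complex.reCLM.compLp w), Complex.reCLM.coeFn_compLp w,
    coeFn_conjL2 w] with x h1 h2 h3
  rw [h] at h3
  rw [h1, h2]
  exact (Complex.conj_eq_iff_re.1 h3.symm)

/-- Real-valuedness on the Fourier side. -/
theorem conjL2_fourierInv_of_symm {H : Lp (α := RN N) ℂ 2 volume}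
    (h : conjL2 (dilate (by norm_num : (-1 : ℝ) ≠ 0) H) = H) :
    conjL2 (𝓕⁻ H : Lp (α := RN N) ℂ 2 volume) = 𝓕⁻ H := by
  have h1 := fourier_conjL2 (𝓕⁻ H : Lp (α := RN N) ℂ 2 volume)
  rw [FourierTransform.fourier_fourierInv_eq, h] at h1
  have h2 := congrArg (fun f : Lp (α := RN N) ℂ 2 volume =>
    (𝓕⁻ f : Lp (α := RN N) ℂ 2 volume)) h1
  simpa using h2

theorem fourierL2_symm (u : L2 N) :
    conjL2 (dilate (by norm_num : (-1 : ℝ) ≠ 0) (fourierL2 N u)) = fourierL2 N u := by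
  unfold fourierL2
  rw [← fourier_conjL2, conjL2_ofReal]

/-- The class `(2π|ξ|)^s 𝓕 u` in `L²`. -/
def symbolL2 (u : Hs N s) : Lp (α := RN N) ℂ 2 volume :=
  (memLp_of_Hs u).toLp (halfSymbolMul N s (u : L2 N))

theorem coeFn_symbolL2 (u : Hs N s) :
    symbolL2 u =ᵐ[volume] halfSymbolMul N s (u : L2 N) :=
  MemLp.coeFn_toLp _

/-- The multiplier is real and even, so it preserves the Hermitian symmetry of `𝓕 u`. -/
theorem symbolL2_symm (u : Hs N s) :
    conjL2 (dilate (by norm_num : (-1 : ℝ) ≠ 0) (symbolL2 u)) = symbolL2 u := by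
  refine Lp.ext ?_
  have hq := quasiMeasurePreserving_smul_RN (N := N) (by norm_num : (-1 : ℝ) ≠ 0)
  have hs := fourierL2_symm (u : L2 N)
  filter_upwards [coeFn_conjL2 (dilate (by norm_num : (-1 : ℝ) ≠ 0) (symbolL2 u)),
    coeFn_dilate (by norm_num : (-1 : ℝ) ≠ 0) (symbolL2 u), hq.ae (coeFn_symbolL2 u),
    coeFn_symbolL2 u, coeFn_conjL2 (dilate (by norm_num : (-1 : ℝ) ≠ 0) (fourierL2 N (u : L2 N))),
    coeFn_dilate (by norm_num : (-1 : ℝ) ≠ 0) (fourierL2 N (u : L2 N))] with x h1 h2 h3 h4 h5 h6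
  rw [h1, h2, h3, h4]
  rw [hs, h6] at h5
  simp only [halfSymbolMul]
  rw [h5, map_mul, Complex.conj_ofReal]
  simp

/-- The real part in `halfLap` discards nothing, which is why Plancherel holds as an equality below.
-/
theorem ofReal_halfLap (u : Hs N s) :
    Complex.ofRealCLM.compLp (halfLap u) = (𝓕⁻ (symbolL2 u) : Lp (α := RN N) ℂ 2 volume) :=
  ofReal_re_compLp (conjL2_fourierInv_of_symm (symbolL2_symm u))

theorem norm_ofReal_compLp (f : L2 N) :
    ‖(Complex.ofRealCLM.compLp f : Lp (α := RN N) ℂ 2 volume)‖ = ‖f‖ := by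
  rw [Lp.norm_def, Lp.norm_def]
  congr 1
  refine eLpNorm_congr_norm_ae ?_
  filter_upwards [coeFn_ofReal_compLp f] with x hx
  rw [hx, Complex.norm_real]

theorem norm_sq_eq_integral {𝕜 : Type*} [RCLike 𝕜] (f : Lp (α := RN N) 𝕜 2 volume) :
    ‖f‖ ^ 2 = ∫ x, ‖f x‖ ^ 2 := by
  have h := inner_self_eq_norm_sq_to_K (𝕜 := 𝕜) f
  rw [L2.inner_def] at h
  have h2 : ∀ x, inner 𝕜 (f x) (f x) = ((‖f x‖ ^ 2 : ℝ) : 𝕜) := fun x => by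
    rw [inner_self_eq_norm_sq_to_K]; simp
  simp_rw [h2] at h
  rw [integral_ofReal] at h
  exact_mod_cast h.symm

theorem norm_sq_eq_integral_sq (f : L2 N) : ‖f‖ ^ 2 = ∫ x, (f x) ^ 2 := by
  rw [norm_sq_eq_integral]
  simp

theorem norm_fourierInv_L2 (w : Lp (α := RN N) ℂ 2 volume) :
    ‖(𝓕⁻ w : Lp (α := RN N) ℂ 2 volume)‖ = ‖w‖ := by
  rw [← Lp.norm_fourier_eq, FourierTransform.fourier_fourierInv_eq]

/-- Plancherel for the half Laplacian. -/
theorem gradSq_eq_norm_symbol (u : Hs N s) : gradSq u = ‖symbolL2 u‖ ^ 2 := by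
  rw [gradSq, ← norm_sq_eq_integral_sq, ← norm_ofReal_compLp, ofReal_halfLap, norm_fourierInv_L2]

theorem gradSq_eq_integral (u : Hs N s) :
    gradSq u = ∫ ξ, ‖halfSymbolMul N s (u : L2 N) ξ‖ ^ 2 := by
  rw [gradSq_eq_norm_symbol, norm_sq_eq_integral]
  refine integral_congr_ae ?_
  filter_upwards [coeFn_symbolL2 u] with x hx
  rw [hx]

theorem mass_eq_norm_sq (u : Hs N s) : mass u = ‖(u : L2 N)‖ ^ 2 :=
  (norm_sq_eq_integral_sq _).symm

theorem mass_pos {u : Hs N s} (hu : u ≠ 0) : 0 < mass u := by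
  rw [mass_eq_norm_sq]
  have : (u : L2 N) ≠ 0 := by simpa using hu
  positivity

theorem fourierL2_injective : Function.Injective (fourierL2 N) := by
  intro u v h
  have h1 := (Lp.fourierTransformₗᵢ (RN N) ℂ).injective h
  refine Lp.ext ?_
  filter_upwards [coeFn_ofReal_compLp u, coeFn_ofReal_compLp v] with x hu hv
  rw [h1, hv] at hu
  exact_mod_cast hu.symm

theorem gradSq_nonneg (u : Hs N s) : 0 ≤ gradSq u := by
  rw [gradSq_eq_norm_symbol]; positivity

/-- The multiplier vanishes only at the origin, a null set because `N ≠ 0`; so `gradSq u = 0` forces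
`𝓕 u = 0`. This positivity makes the projection by dilation possible. -/
theorem gradSq_pos (hN : N ≠ 0) {u : Hs N s} (hu : u ≠ 0) : 0 < gradSq u := by
  refine lt_of_le_of_ne (gradSq_nonneg u) fun h => hu ?_
  rw [gradSq_eq_norm_symbol] at h
  have h0 : symbolL2 u = 0 := by
    rw [← norm_eq_zero]; exact pow_eq_zero_iff (two_ne_zero) |>.1 h.symm
  have h1 := coeFn_symbolL2 u
  rw [h0] at h1
  have : Nonempty (Fin N) := ⟨⟨0, Nat.pos_of_ne_zero hN⟩⟩
  have hne : ∀ᵐ ξ : RN N, ξ ≠ 0 := by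
    simp [ae_iff]
  have h2 : fourierL2 N (u : L2 N) = 0 := by
    refine Lp.ext ?_
    filter_upwards [h1, Lp.coeFn_zero ℂ 2 (volume : Measure (RN N)), hne] with ξ h1 h2 h3
    rw [h2] at h1 ⊢
    have : (2 * Real.pi * ‖ξ‖) ^ s ≠ 0 :=
      (Real.rpow_pos_of_pos (by have := norm_pos_iff.2 h3; positivity) s).ne'
    simp only [halfSymbolMul, Pi.zero_apply] at h1
    rcases mul_eq_zero.1 h1.symm with h | h
    · exact absurd (by exact_mod_cast h) this
    · exact h
  have h3 : fourierL2 N 0 = 0 := by simpa using fourierL2_smul N 0 0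
  exact Subtype.ext (fourierL2_injective (h2.trans h3.symm))

theorem halfLap_add (u v : Hs N s) : halfLap (u + v) = halfLap u + halfLap v := by
  have h : symbolL2 (u + v) = symbolL2 u + symbolL2 v := by
    refine Lp.ext ?_
    filter_upwards [coeFn_symbolL2 (u + v), coeFn_symbolL2 u, coeFn_symbolL2 v,
      Lp.coeFn_add (symbolL2 u) (symbolL2 v),
      Lp.coeFn_add (fourierL2 N (u : L2 N)) (fourierL2 N (v : L2 N))] with x h1 h2 h3 h4 h5
    rw [h1, h4, Pi.add_apply, h2, h3]
    simp only [halfSymbolMul, Submodule.coe_add, fourierL2_add, h5, Pi.add_apply]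
    ring
  change Complex.reCLM.compLp (𝓕⁻ (symbolL2 (u + v)) : Lp (α := RN N) ℂ 2 volume) = _
  rw [h]
  have h2 : (𝓕⁻ (symbolL2 u + symbolL2 v) : Lp (α := RN N) ℂ 2 volume)
      = 𝓕⁻ (symbolL2 u) + 𝓕⁻ (symbolL2 v) := FourierTransform.fourierInv_add _ _
  rw [h2]
  exact (Complex.reCLM.compLpₗ (p := 2) (μ := (volume : Measure (RN N)))).map_add _ _

theorem halfLap_smul (c : ℝ) (u : Hs N s) : halfLap (c • u) = c • halfLap u := by
  have h : symbolL2 (c • u) = (c : ℂ) • symbolL2 u := by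
    refine Lp.ext ?_
    filter_upwards [coeFn_symbolL2 (c • u), coeFn_symbolL2 u,
      Lp.coeFn_smul (c : ℂ) (symbolL2 u),
      Lp.coeFn_smul (c : ℂ) (fourierL2 N (u : L2 N))] with x h1 h2 h3 h4
    rw [h1, h3, Pi.smul_apply, h2]
    simp only [halfSymbolMul, Submodule.coe_smul, fourierL2_smul, h4, Pi.smul_apply, smul_eq_mul]
    ring
  change Complex.reCLM.compLp (𝓕⁻ (symbolL2 (c • u)) : Lp (α := RN N) ℂ 2 volume) = _
  have h2 : (𝓕⁻ ((c : ℂ) • symbolL2 u) : Lp (α := RN N) ℂ 2 volume)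
      = (c : ℂ) • 𝓕⁻ (symbolL2 u) := FourierTransform.fourierInv_smul _ _
  rw [h, h2]
  refine Lp.ext ?_
  filter_upwards [Complex.reCLM.coeFn_compLp
      ((c : ℂ) • (𝓕⁻ (symbolL2 u) : Lp (α := RN N) ℂ 2 volume)),
    Lp.coeFn_smul (c : ℂ) (𝓕⁻ (symbolL2 u) : Lp (α := RN N) ℂ 2 volume),
    Lp.coeFn_smul c (halfLap u),
    Complex.reCLM.coeFn_compLp (𝓕⁻ (symbolL2 u) : Lp (α := RN N) ℂ 2 volume)] with x h1 h2 h3 h4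
  rw [h1, h2, h3]
  simp only [Pi.smul_apply]
  change _ = c • (Complex.reCLM.compLp (𝓕⁻ (symbolL2 u) : Lp (α := RN N) ℂ 2 volume)) x
  rw [h4]
  simp

theorem norm_sq_add_smul (f h : L2 N) (ε : ℝ) :
    ‖f + ε • h‖ ^ 2 = ‖f‖ ^ 2 + 2 * (∫ x, f x * h x) * ε + ‖h‖ ^ 2 * ε ^ 2 := by
  have hi : inner ℝ f h = ∫ x, f x * h x := by
    rw [L2.inner_def]
    refine integral_congr_ae (Eventually.of_forall fun x => ?_)
    simp [mul_comm]
  rw [norm_add_sq_real, inner_smul_right, hi, norm_smul, mul_pow, Real.norm_eq_abs, sq_abs]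
  ring

/-- An exact quadratic polynomial in `ε`, so the first variation can be read off its linear
coefficient. -/
theorem gradSq_add_smul (u φ : Hs N s) (ε : ℝ) :
    gradSq (u + ε • φ) = gradSq u + 2 * (∫ x, halfLap u x * halfLap φ x) * ε
      + gradSq φ * ε ^ 2 := by
  simp only [gradSq, ← norm_sq_eq_integral_sq]
  rw [halfLap_add, halfLap_smul, norm_sq_add_smul]

theorem mass_add_smul (u φ : Hs N s) (ε : ℝ) :
    mass (u + ε • φ) = mass u + 2 * (∫ x, (u : L2 N) x * (φ : L2 N) x) * ε + mass φ * ε ^ 2 := by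
  simp only [mass_eq_norm_sq]
  rw [← norm_sq_add_smul]
  rfl

end HalfLaplacian

/-! ### Scaling of the mass and of the seminorm under dilations -/

section Dilation

variable {N : ℕ} {s : ℝ}

theorem fourierL2_dilate {R : ℝ} (hR : 0 < R) (u : L2 N) :
    fourierL2 N (dilate hR.ne' u)
      = (((R ^ N)⁻¹ : ℝ) : ℂ) • dilate (inv_ne_zero hR.ne') (fourierL2 N u) := by
  unfold fourierL2
  rw [← fourier_dilate hR]
  congr 1
  refine Lp.ext ?_
  filter_upwards [coeFn_ofReal_compLp (dilate hR.ne' u), coeFn_dilate hR.ne' u,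
    coeFn_dilate hR.ne' (Complex.ofRealCLM.compLp u : Lp (α := RN N) ℂ 2 volume),
    (quasiMeasurePreserving_smul_RN (N := N) hR.ne').ae (coeFn_ofReal_compLp u)] with x h1 h2 h3 h4
  rw [h1, h2, h3, h4]

theorem halfSymbolMul_dilate {R : ℝ} (hR : 0 < R) (u : L2 N) :
    halfSymbolMul N s (dilate hR.ne' u) =ᵐ[volume]
      fun ξ => ((R ^ s * (R ^ N)⁻¹ : ℝ) : ℂ) * halfSymbolMul N s u (R⁻¹ • ξ) := by
  filter_upwards [Lp.coeFn_smul (((R ^ N)⁻¹ : ℝ) : ℂ)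
      (dilate (inv_ne_zero hR.ne') (fourierL2 N u)),
    coeFn_dilate (inv_ne_zero hR.ne') (fourierL2 N u)] with ξ h1 h2
  have h3 : (2 * Real.pi * ‖ξ‖) ^ s = R ^ s * (2 * Real.pi * ‖R⁻¹ • ξ‖) ^ s := by
    rw [← Real.mul_rpow hR.le (by positivity), norm_smul, Real.norm_of_nonneg (by positivity)]
    congr 1
    field_simp
  simp only [halfSymbolMul]
  rw [fourierL2_dilate hR, h1, Pi.smul_apply, h2, h3, smul_eq_mul]
  push_cast
  ring

/-- The dilation `x ↦ u (R x)` on `H^s`. -/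
def dilateHs {R : ℝ} (hR : 0 < R) (u : Hs N s) : Hs N s :=
  ⟨dilate hR.ne' (u : L2 N), by
    change MemLp _ _ _
    refine (memLp_congr_ae (halfSymbolMul_dilate hR _)).2 ?_
    exact (memLp_two_comp_smul (memLp_of_Hs u) (inv_ne_zero hR.ne')).const_mul _⟩

theorem coeFn_dilateHs {R : ℝ} (hR : 0 < R) (u : Hs N s) :
    (dilateHs hR u : L2 N) =ᵐ[volume] fun x => (u : L2 N) (R • x) :=
  coeFn_dilate hR.ne' _

theorem integral_comp_dilateHs {R : ℝ} (hR : 0 < R) (u : Hs N s) (f : ℝ → ℝ) :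
    ∫ x, f ((dilateHs hR u : L2 N) x) = (R ^ N)⁻¹ * ∫ x, f ((u : L2 N) x) := by
  rw [← smul_eq_mul, ← integral_comp_smul_RN _ hR]
  refine integral_congr_ae ?_
  filter_upwards [coeFn_dilateHs hR u] with x hx
  rw [hx]

theorem integrable_comp_dilateHs {R : ℝ} (hR : 0 < R) (u : Hs N s) {f : ℝ → ℝ}
    (hf : Integrable fun x => f ((u : L2 N) x)) :
    Integrable fun x => f ((dilateHs hR u : L2 N) x) := by
  refine ((integrable_comp_smul_iff volume (fun x => f ((u : L2 N) x)) hR.ne').2 hf).congr ?_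
  filter_upwards [coeFn_dilateHs hR u] with x hx
  rw [hx]

theorem mass_dilateHs {R : ℝ} (hR : 0 < R) (u : Hs N s) :
    mass (dilateHs hR u) = (R ^ N)⁻¹ * mass u :=
  integral_comp_dilateHs hR u fun t => t ^ 2

/-- The squared prefactor `R^(2s-2N)` meets the Jacobian `R^N`. The extra `R^(2s)` compared with the
mass is what lets a dilation solve the Pohožaev equation. -/
theorem gradSq_dilateHs {R : ℝ} (hR : 0 < R) (u : Hs N s) :
    gradSq (dilateHs hR u) = R ^ (2 * s) * (R ^ N)⁻¹ * gradSq u := by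
  rw [gradSq_eq_integral, gradSq_eq_integral]
  have h1 : ∫ ξ, ‖halfSymbolMul N s (dilateHs hR u : L2 N) ξ‖ ^ 2
      = ∫ ξ, (R ^ s * (R ^ N)⁻¹) ^ 2 * ‖halfSymbolMul N s (u : L2 N) (R⁻¹ • ξ)‖ ^ 2 := by
    refine integral_congr_ae ?_
    filter_upwards [halfSymbolMul_dilate (s := s) hR (u : L2 N)] with ξ hξ
    have : halfSymbolMul N s (dilateHs hR u : L2 N) ξ = _ := hξ
    rw [this, norm_mul, mul_pow, Complex.norm_real, Real.norm_eq_abs, sq_abs]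
  rw [h1, integral_const_mul,
    integral_comp_smul_RN (fun ξ => ‖halfSymbolMul N s (u : L2 N) ξ‖ ^ 2) (inv_pos.2 hR),
    mul_comm 2 s, Real.rpow_mul hR.le, smul_eq_mul, Real.rpow_two, inv_pow, inv_inv]
  have : R ^ N ≠ 0 := by positivity
  field_simp

end Dilation

/-! ### Sobolev embedding by frequency splitting and the layer-cake formula -/

section Sobolev

variable {N : ℕ} {s : ℝ}

/-- In polar coordinates the integrand is `r^(N-1-a)`, integrable at `0` exactly when `a < N`. -/
theorem integrableOn_ball_rpow_norm (hN : N ≠ 0) {a : ℝ} (ha : a < N) (A : ℝ) :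
    IntegrableOn (fun ξ : RN N => ‖ξ‖ ^ (-a)) (Metric.ball 0 A) := by
  have : Nonempty (Fin N) := ⟨⟨0, Nat.pos_of_ne_zero hN⟩⟩
  rw [integrableOn_fun_norm_addHaar volume (f := fun y : ℝ => y ^ (-a))]
  have h := intervalIntegral.intervalIntegrable_rpow' (a := 0) (b := A) (r := N - 1 - a)
    (by linarith)
  refine IntegrableOn.congr_fun (s := Set.Ioo 0 A) (h.1.mono_set Set.Ioo_subset_Ioc_self) ?_
    measurableSet_Ioo
  intro y hy
  simp only [finrank_euclideanSpace, Fintype.card_fin, smul_eq_mul]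
  rw [← Real.rpow_natCast, ← Real.rpow_add hy.1, Nat.cast_sub (Nat.one_le_iff_ne_zero.2 hN)]
  congr 1
  push_cast
  ring

/-- Pure scaling; `a < N` is not required because divergent integrals take the value `0` on both
sides. -/
theorem integral_ball_rpow_norm (a : ℝ) {A : ℝ} (hA : 0 < A) :
    ∫ ξ in Metric.ball (0 : RN N) A, ‖ξ‖ ^ (-a)
      = A ^ ((N : ℝ) - a) * ∫ ξ in Metric.ball (0 : RN N) 1, ‖ξ‖ ^ (-a) := by
  rw [← integral_indicator measurableSet_ball, ← integral_indicator measurableSet_ball]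
  have h := integral_comp_smul_RN
    ((Metric.ball (0 : RN N) A).indicator fun ξ => ‖ξ‖ ^ (-a)) hA
  have h2 : ∀ x : RN N, (Metric.ball (0 : RN N) A).indicator (fun ξ => ‖ξ‖ ^ (-a)) (A • x)
      = A ^ (-a) * (Metric.ball (0 : RN N) 1).indicator (fun ξ => ‖ξ‖ ^ (-a)) x := by
    intro x
    have hn : ‖A • x‖ = A * ‖x‖ := by rw [norm_smul, Real.norm_of_nonneg hA.le]
    by_cases hx : ‖x‖ < 1
    · have hx' : ‖A • x‖ < A := by rw [hn]; nlinarith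
      rw [Set.indicator_of_mem (by simpa using hx'), Set.indicator_of_mem (by simpa using hx), hn,
        Real.mul_rpow hA.le (norm_nonneg _)]
    · have hx' : ¬ ‖A • x‖ < A := by rw [hn]; nlinarith
      rw [Set.indicator_of_notMem (by simpa using hx'),
        Set.indicator_of_notMem (by simpa using hx), mul_zero]
  simp_rw [h2] at h
  rw [integral_const_mul, smul_eq_mul] at h
  have hAN : (A ^ N : ℝ) ≠ 0 := by positivity
  rw [Real.rpow_sub hA, Real.rpow_natCast, div_eq_mul_inv, ← Real.rpow_neg hA.le, mul_assoc, h,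
    mul_inv_cancel_left₀ hAN]

/-- The low-frequency part `𝟙_{|ξ| < A} w`. -/
def lowPart (w : Lp (α := RN N) ℂ 2 volume) (A : ℝ) : Lp (α := RN N) ℂ 2 volume :=
  ((Lp.memLp w).indicator (s := Metric.ball (0 : RN N) A) measurableSet_ball).toLp _

theorem coeFn_lowPart (w : Lp (α := RN N) ℂ 2 volume) (A : ℝ) :
    lowPart w A =ᵐ[volume] (Metric.ball (0 : RN N) A).indicator w :=
  MemLp.coeFn_toLp _

theorem integrable_symbol_sq (u : Hs N s) :
    Integrable fun ξ => ‖halfSymbolMul N s (u : L2 N) ξ‖ ^ 2 :=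
  (memLp_two_iff_integrable_sq_norm (memLp_of_Hs u).1).1 (memLp_of_Hs u)

theorem ae_ne_zero_RN (hN : N ≠ 0) : ∀ᵐ ξ : RN N, ξ ≠ 0 := by
  have : Nonempty (Fin N) := ⟨⟨0, Nat.pos_of_ne_zero hN⟩⟩
  simp [ae_iff]

/-- The low-frequency part of an `H^s` function has integrable Fourier transform, with the
scaling-critical bound on its `L¹` norm. -/
theorem exists_integral_lowPart_le (hN : N ≠ 0) (hs : 2 * s < N) (u : Hs N s) :
    ∃ C : ℝ, 0 ≤ C ∧ ∀ A : ℝ, 0 < A →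
      Integrable (lowPart (fourierL2 N (u : L2 N)) A : RN N → ℂ) ∧
      ∫ ξ, ‖lowPart (fourierL2 N (u : L2 N)) A ξ‖ ≤ C * A ^ (((N : ℝ) - 2 * s) / 2) := by
  set I := ∫ ξ in Metric.ball (0 : RN N) 1, ‖ξ‖ ^ (-(2 * s)) with hI
  set c : ℝ := (2 * Real.pi) ^ (-s) with hc
  have hc0 : 0 < c := by positivity
  have hI0 : 0 ≤ I := setIntegral_nonneg measurableSet_ball fun x _ => by positivity
  refine ⟨c * (I + gradSq u), by have := gradSq_nonneg u; positivity, fun A hA => ?_⟩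
  set β : ℝ := ((N : ℝ) - 2 * s) / 2 with hβ
  set w := fourierL2 N (u : L2 N) with hw
  have hAβ : 0 < A ^ β := by positivity
  -- Weighted AM-GM for `|ξ|^(-s)` times `(2π|ξ|)^s |𝓕 u|`. The weight `A^β` balances the terms,
  -- since `∫_{|ξ|<A} |ξ|^(-2s)` is a multiple of `A^(2β)`.
  set F : RN N → ℝ := fun ξ => c * ((A ^ β)⁻¹ *
      (Metric.ball (0 : RN N) A).indicator (fun ξ => ‖ξ‖ ^ (-(2 * s))) ξ
      + A ^ β * ‖halfSymbolMul N s (u : L2 N) ξ‖ ^ 2) with hF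
  have hint1 : Integrable ((Metric.ball (0 : RN N) A).indicator fun ξ => ‖ξ‖ ^ (-(2 * s))) :=
    (integrable_indicator_iff measurableSet_ball).2 (integrableOn_ball_rpow_norm hN hs A)
  have hFint : Integrable F :=
    ((hint1.const_mul _).add ((integrable_symbol_sq u).const_mul _)).const_mul _
  have hbound : ∀ᵐ ξ, ‖lowPart w A ξ‖ ≤ F ξ := by
    filter_upwards [coeFn_lowPart w A, ae_ne_zero_RN hN] with ξ h1 h2
    rw [h1]
    by_cases hξ : ξ ∈ Metric.ball (0 : RN N) A
    · simp only [hF]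
      rw [Set.indicator_of_mem hξ, Set.indicator_of_mem hξ]
      have hn : 0 < ‖ξ‖ := norm_pos_iff.2 h2
      set a : ℝ := ‖ξ‖ ^ (-s) with ha
      have ha0 : 0 < a := by positivity
      set b : ℝ := ‖halfSymbolMul N s (u : L2 N) ξ‖ with hb
      have hab : ‖w ξ‖ = c * (a * b) := by
        rw [hb, halfSymbolMul, norm_mul, Complex.norm_real, Real.norm_of_nonneg (by positivity),
          Real.mul_rpow (by positivity) hn.le, hc, ha, Real.rpow_neg (by positivity),
          Real.rpow_neg hn.le]
        have h1 : (2 * Real.pi) ^ s ≠ 0 := by positivity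
        have h2 : ‖ξ‖ ^ s ≠ 0 := by positivity
        field_simp
        rfl
      have ha2 : ‖ξ‖ ^ (-(2 * s)) = a ^ 2 := by
        rw [ha, ← Real.rpow_natCast, ← Real.rpow_mul hn.le]
        congr 1; push_cast; ring
      rw [hab, ha2]
      refine mul_le_mul_of_nonneg_left ?_ hc0.le
      set B := A ^ β
      have hB : B⁻¹ * a ^ 2 + B * b ^ 2 - a * b
          = B⁻¹ * ((a - B * b / 2) ^ 2 + 3 / 4 * (B * b) ^ 2) := by
        field_simp
        ring
      have : 0 ≤ B⁻¹ * ((a - B * b / 2) ^ 2 + 3 / 4 * (B * b) ^ 2) := by positivity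
      linarith
    · rw [Set.indicator_of_notMem hξ, norm_zero]
      simp only [hF]
      rw [Set.indicator_of_notMem hξ]
      positivity
  refine ⟨hFint.mono' (Lp.aestronglyMeasurable _) hbound, ?_⟩
  refine (integral_mono_ae ((hFint.mono' (Lp.aestronglyMeasurable _) hbound).norm) hFint
    hbound).trans ?_
  rw [integral_const_mul, integral_add (hint1.const_mul _) ((integrable_symbol_sq u).const_mul _),
    integral_const_mul, integral_const_mul, integral_indicator measurableSet_ball,
    integral_ball_rpow_norm _ hA, ← gradSq_eq_integral, ← hI]
  have h2 : A ^ ((N : ℝ) - 2 * s) = A ^ β * A ^ β := by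
    rw [← Real.rpow_add hA]; congr 1; ring
  rw [h2]
  refine le_of_eq ?_
  field_simp

theorem lintegral_ofReal_norm_sq (f : Lp (α := RN N) ℂ 2 volume) :
    ∫⁻ x, ENNReal.ofReal (‖f x‖ ^ 2) = ENNReal.ofReal (‖f‖ ^ 2) := by
  rw [norm_sq_eq_integral, ofReal_integral_eq_lintegral_ofReal]
  · exact (memLp_two_iff_integrable_sq_norm (Lp.memLp f).1).1 (Lp.memLp f)
  · exact Eventually.of_forall fun x => by positivity

/-- Distribution function estimate: the level sets of `u ∈ H^s` are controlled by high
frequencies. -/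
theorem exists_meas_lt_le (hN : N ≠ 0) (hs : 2 * s < N) (u : Hs N s) :
    ∃ κ : ℝ, 0 < κ ∧ ∀ t : ℝ, 0 < t →
      ENNReal.ofReal (t ^ 2 / 4) * volume {x | t < |(u : L2 N) x|} ≤
        ∫⁻ ξ, if t ≤ κ * ‖ξ‖ ^ (((N : ℝ) - 2 * s) / 2)
          then ENNReal.ofReal (‖fourierL2 N (u : L2 N) ξ‖ ^ 2) else 0 := by
  obtain ⟨C, hC, hlow⟩ := exists_integral_lowPart_le hN hs u
  set β : ℝ := ((N : ℝ) - 2 * s) / 2 with hβ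
  have hβ0 : 0 < β := by rw [hβ]; linarith
  refine ⟨2 * (C + 1), by positivity, fun t ht => ?_⟩
  set w := fourierL2 N (u : L2 N) with hw
  -- The cutoff making the low-frequency part at most `t/2` in sup norm; `C + 1` avoids division by
  -- zero.
  set A : ℝ := (t / (2 * (C + 1))) ^ β⁻¹ with hA
  have hA0 : 0 < A := by positivity
  have hAβ : A ^ β = t / (2 * (C + 1)) := by
    rw [hA, Real.rpow_inv_rpow (by positivity) hβ0.ne']
  obtain ⟨hi, hb⟩ := hlow A hA0
  have hb' : ∫ ξ, ‖lowPart w A ξ‖ ≤ t / 2 := by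
    refine hb.trans ?_
    rw [hAβ, mul_div_assoc', div_le_div_iff₀ (by positivity) (by positivity)]
    nlinarith
  set h : Lp (α := RN N) ℂ 2 volume := 𝓕⁻ (w - lowPart w A) with hh
  have hsub : h = Complex.ofRealCLM.compLp (u : L2 N) - 𝓕⁻ (lowPart w A) := by
    have h1 : (𝓕⁻ w : Lp (α := RN N) ℂ 2 volume) = Complex.ofRealCLM.compLp (u : L2 N) :=
      FourierTransform.fourierInv_fourier_eq _
    rw [hh, ← h1]
    exact (Lp.fourierTransformₗᵢ (RN N) ℂ).symm.map_sub _ _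
  -- Where `|u| > t`, the high-frequency part `h` must be at least `t/2`; Chebyshev and Plancherel
  -- then apply to `h`.
  have hmeas : volume {x | t < |(u : L2 N) x|} ≤
      volume {x | ENNReal.ofReal (t ^ 2 / 4) ≤ ENNReal.ofReal (‖h x‖ ^ 2)} := by
    refine measure_mono_ae ?_
    filter_upwards [coeFn_ofReal_compLp (u : L2 N), norm_fourierInv_le_of_integrable _ hi,
      Lp.coeFn_sub (Complex.ofRealCLM.compLp (u : L2 N)) (𝓕⁻ (lowPart w A))] with x h1 h2 h3 h4
    have h4' : t < |(u : L2 N) x| := h4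
    refine ENNReal.ofReal_le_ofReal ?_
    rw [hsub, h3, Pi.sub_apply, h1]
    have h5 := norm_sub_norm_le ((u : L2 N) x : ℂ)
      ((𝓕⁻ (lowPart w A) : Lp (α := RN N) ℂ 2 volume) x)
    rw [Complex.norm_real, Real.norm_eq_abs] at h5
    have h6 : t / 2 ≤ ‖((u : L2 N) x : ℂ) -
      (𝓕⁻ (lowPart w A) : Lp (α := RN N) ℂ 2 volume) x‖ := by linarith
    nlinarith
  refine (mul_le_mul_right hmeas _).trans ?_
  refine (mul_meas_ge_le_lintegral₀
    ((Lp.aestronglyMeasurable h).norm.aemeasurable.pow_const 2).ennreal_ofReal _).trans ?_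
  rw [lintegral_ofReal_norm_sq, hh, norm_fourierInv_L2, ← lintegral_ofReal_norm_sq]
  refine lintegral_mono_ae ?_
  filter_upwards [Lp.coeFn_sub w (lowPart w A), coeFn_lowPart w A] with ξ h1 h2
  rw [h1, Pi.sub_apply, h2]
  by_cases hξ : ξ ∈ Metric.ball (0 : RN N) A
  · rw [Set.indicator_of_mem hξ, sub_self]
    simp
  · rw [Set.indicator_of_notMem hξ, sub_zero, if_pos]
    have hξ' : A ≤ ‖ξ‖ := by simpa using hξ
    have := Real.rpow_le_rpow hA0.le hξ' hβ0.le
    rw [hAβ, div_le_iff₀ (by positivity)] at this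
    linarith

theorem lintegral_Ioi_rpow_le {q T : ℝ} (hq : 0 < q) (hT : 0 ≤ T) :
    ∫⁻ t in Set.Ioi (0 : ℝ), (if t ≤ T then ENNReal.ofReal (4 * t ^ (q - 1)) else 0)
      = ENNReal.ofReal (4 / q * T ^ q) := by
  have h1 : ∀ t : ℝ, (if t ≤ T then ENNReal.ofReal (4 * t ^ (q - 1)) else 0)
      = (Set.Iic T).indicator (fun t => ENNReal.ofReal (4 * t ^ (q - 1))) t := fun t => rfl
  simp_rw [h1]
  rw [setLIntegral_indicator measurableSet_Iic, Set.Iic_inter_Ioi,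
    ← ofReal_integral_eq_lintegral_ofReal]
  · rw [← intervalIntegral.integral_of_le hT, intervalIntegral.integral_const_mul,
      integral_rpow (Or.inl (by linarith))]
    congr 1
    rw [sub_add_cancel, Real.zero_rpow hq.ne', sub_zero]
    ring
  · exact ((intervalIntegral.intervalIntegrable_rpow' (by linarith)).1).const_mul _
  · filter_upwards [ae_restrict_mem measurableSet_Ioc] with t ht
    have := ht.1
    positivity

/-- The fractional Sobolev embedding `H^s ⊂ L^{2*_s}`, in integrability form. -/
theorem integrable_rpow_critExp (hN : N ≠ 0) (hs0 : 0 < s) (hs : 2 * s < N) (u : Hs N s) :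
    Integrable fun x => |(u : L2 N) x| ^ critExp N s := by
  obtain ⟨κ, hκ, hdist⟩ := exists_meas_lt_le hN hs u
  set β : ℝ := ((N : ℝ) - 2 * s) / 2 with hβ
  have hβ0 : 0 < β := by rw [hβ]; linarith
  set p := critExp N s with hp
  -- The exponent match that singles out `2*_s`: integrating `t^(p-3)` up to `κ|ξ|^β` yields a
  -- multiple of `|ξ|^(2s)`, the weight controlled by `H^s`.
  have hpβ : β * (p - 2) = 2 * s := by
    rw [hp, critExp, hβ]
    have : (N : ℝ) - 2 * s ≠ 0 := by linarith
    field_simp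
    ring
  have hp2 : 0 < p - 2 := by
    by_contra hcon
    nlinarith
  set w := fourierL2 N (u : L2 N) with hw
  have hum : AEMeasurable (fun x => |(u : L2 N) x|) volume :=
    (Lp.aestronglyMeasurable (u : L2 N)).norm.aemeasurable
  have hwm : Measurable fun ξ => w ξ := (Lp.stronglyMeasurable w).measurable
  have key : ∫⁻ x, ENNReal.ofReal (|(u : L2 N) x| ^ p) < ⊤ := by
    rw [lintegral_rpow_eq_lintegral_meas_lt_mul volume (Eventually.of_forall fun x => abs_nonneg _)
      hum (by linarith)]
    refine ENNReal.mul_lt_top ENNReal.ofReal_lt_top ?_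
    have h1 : ∫⁻ t in Set.Ioi (0 : ℝ),
          volume {a | t < |(u : L2 N) a|} * ENNReal.ofReal (t ^ (p - 1))
        ≤ ∫⁻ t in Set.Ioi (0 : ℝ), ∫⁻ ξ, ENNReal.ofReal (‖w ξ‖ ^ 2) *
          (if t ≤ κ * ‖ξ‖ ^ β then ENNReal.ofReal (4 * t ^ (p - 2 - 1)) else 0) := by
      refine setLIntegral_mono' measurableSet_Ioi fun t ht => ?_
      have ht0 : 0 < t := ht
      have h2 : ENNReal.ofReal (t ^ (p - 1))
          = ENNReal.ofReal (t ^ 2 / 4) * ENNReal.ofReal (4 * t ^ (p - 2 - 1)) := by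
        rw [← ENNReal.ofReal_mul (by positivity)]
        congr 1
        have : t ^ (p - 1) = t ^ 2 * t ^ (p - 2 - 1) := by
          rw [← Real.rpow_natCast t 2, ← Real.rpow_add ht0]
          congr 1; push_cast; ring
        rw [this]; ring
      calc volume {a | t < |(u : L2 N) a|} * ENNReal.ofReal (t ^ (p - 1))
          = (ENNReal.ofReal (t ^ 2 / 4) * volume {a | t < |(u : L2 N) a|})
            * ENNReal.ofReal (4 * t ^ (p - 2 - 1)) := by rw [h2]; ring
        _ ≤ (∫⁻ ξ, if t ≤ κ * ‖ξ‖ ^ β then ENNReal.ofReal (‖w ξ‖ ^ 2) else 0)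
            * ENNReal.ofReal (4 * t ^ (p - 2 - 1)) := by gcongr; exact hdist t ht0
        _ = ∫⁻ ξ, (if t ≤ κ * ‖ξ‖ ^ β then ENNReal.ofReal (‖w ξ‖ ^ 2) else 0)
            * ENNReal.ofReal (4 * t ^ (p - 2 - 1)) := by
          rw [lintegral_mul_const' _ _ ENNReal.ofReal_ne_top]
        _ = _ := by
          refine lintegral_congr fun ξ => ?_
          split_ifs <;> simp
    refine h1.trans_lt ?_
    rw [lintegral_lintegral_swap]
    · have h3 : ∀ ξ : RN N, ∫⁻ t in Set.Ioi (0 : ℝ), ENNReal.ofReal (‖w ξ‖ ^ 2) *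
          (if t ≤ κ * ‖ξ‖ ^ β then ENNReal.ofReal (4 * t ^ (p - 2 - 1)) else 0)
          = ENNReal.ofReal (4 / (p - 2) * κ ^ (p - 2) * ((2 * Real.pi) ^ (2 * s))⁻¹ *
            ‖halfSymbolMul N s (u : L2 N) ξ‖ ^ 2) := by
        intro ξ
        rw [lintegral_const_mul' _ _ ENNReal.ofReal_ne_top,
          lintegral_Ioi_rpow_le hp2 (by positivity), ← ENNReal.ofReal_mul (by positivity)]
        congr 1
        rw [Real.mul_rpow hκ.le (by positivity), ← Real.rpow_mul (norm_nonneg _), hpβ,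
          halfSymbolMul, norm_mul, mul_pow, Complex.norm_real,
          Real.norm_of_nonneg (by positivity), ← Real.rpow_natCast _ 2, ← Real.rpow_natCast _ 2,
          ← Real.rpow_mul (by positivity), Real.mul_rpow (by positivity) (norm_nonneg _)]
        have : (2 * Real.pi) ^ (2 * s) ≠ 0 := by positivity
        rw [show s * ((2 : ℕ) : ℝ) = 2 * s by push_cast; ring]
        field_simp
      simp_rw [h3]
      exact ((integrable_symbol_sq u).const_mul _).lintegral_lt_top
    · refine Measurable.aemeasurable ?_
      refine Measurable.mul (by fun_prop) (Measurable.ite ?_ (by fun_prop) measurable_const)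
      exact measurableSet_le (by fun_prop) (by fun_prop)
  refine ⟨(hum.pow_const p).aestronglyMeasurable, ?_⟩
  rw [hasFiniteIntegral_iff_ofReal (Eventually.of_forall fun x => by positivity)]
  exact key

end Sobolev

/-! ### Pointwise bounds on `g` and its primitive -/

section Growth

variable {N : ℕ} {s : ℝ} {g : ℝ → ℝ}

theorem two_lt_critExp (hs0 : 0 < s) (hs : 2 * s < N) : 2 < critExp N s := by
  rw [critExp, lt_div_iff₀ (by linarith)]
  linarith

theorem G2.exists_growth (h0 : G0 g) (h2 : G2 N s g) (hs0 : 0 < s) (hs : 2 * s < N) :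
    ∃ C : ℝ, 0 ≤ C ∧ ∀ t, |g t| ≤ C * (1 + |t| ^ (critExp N s - 1)) := by
  set p := critExp N s
  have hp : 2 < p := two_lt_critExp hs0 hs
  obtain ⟨K, hK1, -⟩ := EReal.lt_iff_exists_real_btwn.1 h2
  have hev : ∀ᶠ t in cocompact ℝ, |g t| / |t| ^ (p - 1) < K := by
    filter_upwards [eventually_lt_of_limsup_lt hK1] with t ht
    exact_mod_cast ht
  obtain ⟨S, hS, hSK⟩ := mem_cocompact.1 hev
  -- The origin is adjoined so that off this compact set `|t|^(p-1) > 0` and the quotient bound can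
  -- be cleared.
  have hSc := hS.union (isCompact_singleton (x := (0 : ℝ)))
  obtain ⟨B, hB⟩ := hSc.exists_bound_of_continuousOn h0.1.continuousOn
  refine ⟨max B 0 + max K 0, by positivity, fun t => ?_⟩
  have hr : 0 ≤ |t| ^ (p - 1) := by positivity
  have hB0 := le_max_right B 0
  have hK0 := le_max_right K 0
  by_cases ht : t ∈ S ∪ {0}
  · have := hB t ht
    rw [Real.norm_eq_abs] at this
    have h3 := le_max_left B 0
    nlinarith [mul_nonneg hB0 hr, mul_nonneg hK0 hr]
  · have htS : t ∉ S := fun h => ht (Or.inl h)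
    have ht0 : t ≠ 0 := fun h => ht (Or.inr h)
    have h3 : |g t| / |t| ^ (p - 1) < K := hSK htS
    have hpos : 0 < |t| ^ (p - 1) := Real.rpow_pos_of_pos (abs_pos.2 ht0) _
    rw [div_lt_iff₀ hpos] at h3
    nlinarith [le_max_left K 0, mul_nonneg hB0 hr]

theorem hasDerivAt_primitive (h0 : G0 g) (t : ℝ) : HasDerivAt (primitive g) (g t) t :=
  intervalIntegral.integral_hasDerivAt_right (h0.1.intervalIntegrable _ _)
    (h0.1.stronglyMeasurableAtFilter _ _) h0.1.continuousAt

theorem continuous_primitive (h0 : G0 g) : Continuous (primitive g) :=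
  continuous_iff_continuousAt.2 fun t => (hasDerivAt_primitive h0 t).continuousAt

theorem primitive_zero : primitive g 0 = 0 := intervalIntegral.integral_same

/-- Near `0` the quotient `g(t)/t` is below `1`, and this integrates to `t²/2` on either side of the
origin. -/
theorem G1.exists_primitive_le (h0 : G0 g) (h1 : G1 g) :
    ∃ δ : ℝ, 0 < δ ∧ ∀ t, |t| < δ → primitive g t ≤ t ^ 2 / 2 := by
  have hev : ∀ᶠ t in 𝓝[≠] (0 : ℝ), g t / t < 1 := by
    have : limsup (fun t : ℝ => ((g t / t : ℝ) : EReal)) (𝓝[≠] 0) < ((1 : ℝ) : EReal) :=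
      lt_of_le_of_lt h1 (by exact_mod_cast one_pos)
    filter_upwards [eventually_lt_of_limsup_lt this] with t ht
    exact_mod_cast ht
  rw [eventually_nhdsWithin_iff, Metric.eventually_nhds_iff] at hev
  obtain ⟨δ, hδ, hd⟩ := hev
  refine ⟨δ, hδ, fun t ht => ?_⟩
  have hsq : ∫ τ in (0 : ℝ)..t, τ = t ^ 2 / 2 := by simp
  rw [← hsq, primitive]
  rcases le_total 0 t with h | h
  · refine intervalIntegral.integral_mono_on h (h0.1.intervalIntegrable _ _)
      (continuous_id.intervalIntegrable _ _) fun τ hτ => ?_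
    rcases hτ.1.eq_or_lt with h' | h'
    · rw [← h', h0.2]
    · have hτδ : dist τ 0 < δ := by
        rw [Real.dist_eq, sub_zero, abs_of_pos h']
        rw [abs_of_nonneg h] at ht
        linarith [hτ.2]
      have := hd hτδ h'.ne'
      rw [div_lt_one h'] at this
      exact this.le
  · rw [intervalIntegral.integral_symm, intervalIntegral.integral_symm t 0]
    refine neg_le_neg (intervalIntegral.integral_mono_on h (continuous_id.intervalIntegrable _ _)
      (h0.1.intervalIntegrable _ _) fun τ hτ => ?_)
    rcases hτ.2.eq_or_lt with h' | h'
    · rw [h', h0.2]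
    · have hτδ : dist τ 0 < δ := by
        rw [Real.dist_eq, sub_zero, abs_of_neg h']
        rw [abs_of_nonpos h] at ht
        linarith [hτ.1]
      have := hd hτδ h'.ne
      rw [div_lt_one_of_neg h'] at this
      exact this.le

theorem abs_primitive_sub_le {C q : ℝ} (hC : 0 ≤ C) (hq : 0 ≤ q) (h0 : G0 g)
    (hg : ∀ t, |g t| ≤ C * (1 + |t| ^ q)) (a b : ℝ) :
    |primitive g (a + b) - primitive g a| ≤ C * (1 + (|a| + |b|) ^ q) * |b| := by
  have h := Convex.norm_image_sub_le_of_norm_hasDerivWithin_le (f := primitive g) (f' := g)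
    (C := C * (1 + (|a| + |b|) ^ q)) (s := segment ℝ a (a + b)) (x := a) (y := a + b)
    (fun x _ => (hasDerivAt_primitive h0 x).hasDerivWithinAt) (fun x hx => ?_)
    (convex_segment _ _) (left_mem_segment _ _ _) (right_mem_segment _ _ _)
  · simpa using h
  · refine (hg x).trans ?_
    have hx' : |x| ≤ |a| + |b| := by
      rw [segment_eq_image'] at hx
      obtain ⟨θ, hθ, rfl⟩ := hx
      have h1 : |θ * b| ≤ |b| := by
        rw [abs_mul, abs_of_nonneg hθ.1]
        exact mul_le_of_le_one_left (abs_nonneg _) hθ.2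
      simp only [add_sub_cancel_left, smul_eq_mul]
      exact (abs_add_le _ _).trans (by linarith)
    gcongr

/-- The growth bound alone gives order `|t|` near `0`, which `u ∈ L²` does not make integrable, so
(g1) is used there; for `|t| ≥ δ`, `|t| ≤ δ⁻¹ t²`. Only an upper bound is available. -/
theorem exists_primitive_le (h0 : G0 g) (h1 : G1 g) (h2 : G2 N s g) (hs0 : 0 < s)
    (hs : 2 * s < N) :
    ∃ C : ℝ, 0 ≤ C ∧ ∀ t, primitive g t ≤ C * (t ^ 2 + |t| ^ critExp N s) := by
  have hp : 2 < critExp N s := two_lt_critExp hs0 hs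
  obtain ⟨C, hC, hg⟩ := h2.exists_growth h0 hs0 hs
  obtain ⟨δ, hδ, hsmall⟩ := h1.exists_primitive_le h0
  refine ⟨1 + C * (1 + δ⁻¹), by positivity, fun t => ?_⟩
  have hr : 0 ≤ |t| ^ critExp N s := by positivity
  have hδ' : 0 < δ⁻¹ := by positivity
  rcases lt_or_ge |t| δ with ht | ht
  · refine (hsmall t ht).trans ?_
    have : 0 ≤ C * (1 + δ⁻¹) := by positivity
    nlinarith [mul_nonneg this (add_nonneg (sq_nonneg t) hr), sq_nonneg t]
  · have h3 := abs_primitive_sub_le hC (by linarith) h0 hg 0 t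
    rw [primitive_zero, zero_add, sub_zero, abs_zero, zero_add] at h3
    have htpos : 0 < |t| := hδ.trans_le ht
    have h4 : |t| ^ (critExp N s - 1) * |t| = |t| ^ critExp N s := by
      rw [← Real.rpow_add_one htpos.ne']; congr 1; ring
    have h5 : |t| ≤ δ⁻¹ * t ^ 2 := by
      rw [← sq_abs, inv_mul_eq_div, le_div_iff₀ hδ]
      nlinarith
    calc primitive g t ≤ |primitive g t| := le_abs_self _
      _ ≤ C * (1 + |t| ^ (critExp N s - 1)) * |t| := h3
      _ = C * (|t| + |t| ^ critExp N s) := by rw [← h4]; ring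
      _ ≤ C * (δ⁻¹ * t ^ 2 + |t| ^ critExp N s) := by gcongr
      _ ≤ (1 + C * (1 + δ⁻¹)) * (t ^ 2 + |t| ^ critExp N s) := by
        have e1 : 0 ≤ C * δ⁻¹ * |t| ^ critExp N s := by positivity
        have e2 : 0 ≤ C * t ^ 2 := by positivity
        nlinarith [sq_nonneg t]

end Growth

/-! ### Integrability of `G(u)` and passage from extended to real values -/

section Potential

variable {N : ℕ} {s : ℝ} {g : ℝ → ℝ}

theorem aestronglyMeasurable_primitive (h0 : G0 g) (u : Hs N s) :
    AEStronglyMeasurable (fun x => primitive g ((u : L2 N) x)) volume :=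
  (continuous_primitive h0).comp_aestronglyMeasurable (Lp.aestronglyMeasurable _)

theorem integrable_sq_Hs (u : Hs N s) : Integrable fun x => (u : L2 N) x ^ 2 := by
  simpa using (memLp_two_iff_integrable_sq_norm (Lp.memLp (u : L2 N)).1).1 (Lp.memLp (u : L2 N))

/-- The positive part is always integrable, so `extIntegral` never meets `∞ - ∞` and `-∞` is the
only exceptional value of the potential. -/
theorem lintegral_primitive_lt_top (hN : N ≠ 0) (h0 : G0 g) (h1 : G1 g) (h2 : G2 N s g)
    (hs0 : 0 < s) (hs : 2 * s < N) (u : Hs N s) :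
    ∫⁻ x, ENNReal.ofReal (primitive g ((u : L2 N) x)) < ⊤ := by
  obtain ⟨C, hC, hG⟩ := exists_primitive_le h0 h1 h2 hs0 hs
  refine lt_of_le_of_lt (lintegral_mono fun x => ENNReal.ofReal_le_ofReal (hG _)) ?_
  exact (((integrable_sq_Hs u).add
    (integrable_rpow_critExp hN hs0 hs u)).const_mul C).lintegral_lt_top

theorem potential_eq_integral {u : Hs N s}
    (hu : Integrable fun x => primitive g ((u : L2 N) x)) :
    potential g u = ((∫ x, primitive g ((u : L2 N) x) : ℝ) : EReal) := by
  have e1 := hu.lintegral_lt_top.ne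
  have e2 := hu.neg.lintegral_lt_top.ne
  simp only [Pi.neg_apply] at e2
  rw [potential, extIntegral, integral_eq_lintegral_pos_part_sub_lintegral_neg_part hu,
    EReal.coe_sub, EReal.coe_ennreal_toReal e1, EReal.coe_ennreal_toReal e2]

theorem integrable_primitive_of_potential (hN : N ≠ 0) (h0 : G0 g) (h1 : G1 g) (h2 : G2 N s g)
    (hs0 : 0 < s) (hs : 2 * s < N) {u : Hs N s} (hu : potential g u ≠ ⊥) :
    Integrable fun x => primitive g ((u : L2 N) x) := by
  have hp := lintegral_primitive_lt_top hN h0 h1 h2 hs0 hs u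
  have hn : ∫⁻ x, ENNReal.ofReal (-primitive g ((u : L2 N) x)) ≠ ⊤ := by
    intro h
    refine hu ?_
    rw [potential, extIntegral, h, EReal.coe_ennreal_top]
    exact EReal.sub_top _
  have hm := aestronglyMeasurable_primitive h0 u
  refine ⟨hm, ?_⟩
  rw [hasFiniteIntegral_iff_norm]
  calc ∫⁻ x, ENNReal.ofReal ‖primitive g ((u : L2 N) x)‖
      ≤ ∫⁻ x, ENNReal.ofReal (primitive g ((u : L2 N) x))
          + ENNReal.ofReal (-primitive g ((u : L2 N) x)) := by
        refine lintegral_mono fun x => ?_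
        rw [Real.norm_eq_abs]
        rcases le_total 0 (primitive g ((u : L2 N) x)) with h | h
        · rw [abs_of_nonneg h]; exact le_self_add
        · rw [abs_of_nonpos h]; exact le_add_self
    _ = _ := lintegral_add_left' hm.aemeasurable.ennreal_ofReal _
    _ < ⊤ := ENNReal.add_lt_top.2 ⟨hp, hn.lt_top⟩

theorem lagrangian_eq {m : ℝ} (μ : ℝ) {u : Hs N s}
    (hu : Integrable fun x => primitive g ((u : L2 N) x)) :
    lagrangian g m (μ, u) = ((1 / 2 * gradSq u + μ / 2 * (mass u - m)
      - ∫ x, primitive g ((u : L2 N) x) : ℝ) : EReal) := by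
  rw [lagrangian, potential_eq_integral hu]
  rfl

theorem energy_eq {u : Hs N s} (hu : Integrable fun x => primitive g ((u : L2 N) x)) :
    energy g u = ((1 / 2 * gradSq u - ∫ x, primitive g ((u : L2 N) x) : ℝ) : EReal) := by
  rw [energy, potential_eq_integral hu]
  rfl

theorem pohozaev_eq (μ : ℝ) {u : Hs N s}
    (hu : Integrable fun x => primitive g ((u : L2 N) x)) :
    pohozaev g (μ, u) = ((gradSq u + critExp N s *
      (μ / 2 * mass u - ∫ x, primitive g ((u : L2 N) x)) : ℝ) : EReal) := by
  rw [pohozaev, potential_eq_integral hu]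
  rfl

theorem potential_ne_bot_of_pohozaev (hs0 : 0 < s) (hs : 2 * s < N) {μ : ℝ} {u : Hs N s}
    (h : pohozaev g (μ, u) = 0) : potential g u ≠ ⊥ := by
  intro hb
  have hp : 0 < critExp N s := by linarith [two_lt_critExp hs0 hs]
  rw [pohozaev, hb, EReal.coe_sub_bot, EReal.coe_mul_top_of_pos hp, EReal.coe_add_top] at h
  exact absurd h (by simp)

end Potential

/-! ### First variation of the potential -/

section Variation

variable {N : ℕ} {s : ℝ} {g : ℝ → ℝ}

theorem rpow_add_le_two_mul {q a b : ℝ} (hq : 0 ≤ q) (ha : 0 ≤ a) (hb : 0 ≤ b) :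
    (a + b) ^ q ≤ 2 ^ q * (a ^ q + b ^ q) := by
  have h2 : (0 : ℝ) ≤ 2 ^ q := by positivity
  rcases le_total a b with h | h
  · calc (a + b) ^ q ≤ (2 * b) ^ q := Real.rpow_le_rpow (by positivity) (by linarith) hq
      _ = 2 ^ q * b ^ q := Real.mul_rpow (by norm_num) hb
      _ ≤ _ := by
        have : 0 ≤ a ^ q := by positivity
        gcongr; linarith
  · calc (a + b) ^ q ≤ (2 * a) ^ q := Real.rpow_le_rpow (by positivity) (by linarith) hq
      _ = 2 ^ q * a ^ q := Real.mul_rpow (by norm_num) ha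
      _ ≤ _ := by
        have : 0 ≤ b ^ q := by positivity
        gcongr; linarith

theorem rpow_mul_le_add {p a b : ℝ} (hp : 1 < p) (ha : 0 ≤ a) (hb : 0 ≤ b) :
    a ^ (p - 1) * b ≤ a ^ p + b ^ p := by
  have key : ∀ c : ℝ, 0 ≤ c → c ^ (p - 1) * c = c ^ p := fun c hc => by
    rcases hc.eq_or_lt with h | h
    · rw [← h, mul_zero, Real.zero_rpow (by linarith)]
    · rw [← Real.rpow_add_one h.ne']; congr 1; ring
  have ha' : 0 ≤ a ^ p := by positivity
  have hb' : 0 ≤ b ^ p := by positivity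
  rcases le_total a b with h | h
  · calc a ^ (p - 1) * b ≤ b ^ (p - 1) * b := by
          gcongr
      _ = b ^ p := key b hb
      _ ≤ _ := by linarith
  · calc a ^ (p - 1) * b ≤ a ^ (p - 1) * a := by gcongr
      _ = a ^ p := key a ha
      _ ≤ _ := by linarith

/-- The envelope dominating the difference quotients of `ε ↦ G (u + ε φ)`. -/
theorem integrable_envelope (hN : N ≠ 0) (hs0 : 0 < s) (hs : 2 * s < N) (u φ : Hs N s)
    (hφ : Integrable fun x => (φ : L2 N) x) (C : ℝ) :
    Integrable fun x => C * (1 + (|(u : L2 N) x| + |(φ : L2 N) x|) ^ (critExp N s - 1))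
      * |(φ : L2 N) x| := by
  have hp := two_lt_critExp hs0 hs
  have hq : 0 ≤ critExp N s - 1 := by linarith
  set q := critExp N s - 1 with hqdef
  have hum := (Lp.aestronglyMeasurable (u : L2 N)).aemeasurable
  have hφm := (Lp.aestronglyMeasurable (φ : L2 N)).aemeasurable
  have hbase : Integrable fun x => (1 + (|(u : L2 N) x| + |(φ : L2 N) x|) ^ q)
      * |(φ : L2 N) x| := by
    -- The term `|φ|` comes from the constant in the growth bound on `g`; it is where `φ ∈ L¹` is
    -- needed.
    have hdom : Integrable fun x => |(φ : L2 N) x| + 2 ^ q * (|(u : L2 N) x| ^ critExp N s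
        + 2 * |(φ : L2 N) x| ^ critExp N s) + 2 ^ q * |(φ : L2 N) x| ^ critExp N s :=
      (hφ.abs.add (((integrable_rpow_critExp hN hs0 hs u).add
        ((integrable_rpow_critExp hN hs0 hs φ).const_mul 2)).const_mul _)).add
        ((integrable_rpow_critExp hN hs0 hs φ).const_mul _)
    refine hdom.mono' ?_ (Eventually.of_forall fun x => ?_)
    · exact (((hum.norm.add hφm.norm).pow_const q).const_add 1 |>.mul hφm.norm).aestronglyMeasurable
    · rw [Real.norm_of_nonneg (by positivity)]
      have h1 := rpow_add_le_two_mul hq (abs_nonneg ((u : L2 N) x)) (abs_nonneg ((φ : L2 N) x))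
      have h2 := rpow_mul_le_add (by linarith : 1 < critExp N s) (abs_nonneg ((u : L2 N) x))
        (abs_nonneg ((φ : L2 N) x))
      have h3 := rpow_mul_le_add (by linarith : 1 < critExp N s) (abs_nonneg ((φ : L2 N) x))
        (abs_nonneg ((φ : L2 N) x))
      rw [← hqdef] at h2 h3
      have h4 : (0 : ℝ) ≤ 2 ^ q := by positivity
      have h5 : 0 ≤ 2 ^ q * |(φ : L2 N) x| ^ critExp N s := by positivity
      calc (1 + (|(u : L2 N) x| + |(φ : L2 N) x|) ^ q) * |(φ : L2 N) x|
          ≤ (1 + 2 ^ q * (|(u : L2 N) x| ^ q + |(φ : L2 N) x| ^ q)) * |(φ : L2 N) x| := by gcongr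
        _ = |(φ : L2 N) x| + 2 ^ q * (|(u : L2 N) x| ^ q * |(φ : L2 N) x|
            + |(φ : L2 N) x| ^ q * |(φ : L2 N) x|) := by ring
        _ ≤ |(φ : L2 N) x| + 2 ^ q * ((|(u : L2 N) x| ^ critExp N s + |(φ : L2 N) x| ^ critExp N s)
            + (|(φ : L2 N) x| ^ critExp N s + |(φ : L2 N) x| ^ critExp N s)) := by gcongr
        _ = |(φ : L2 N) x| + 2 ^ q * (|(u : L2 N) x| ^ critExp N s
            + 2 * |(φ : L2 N) x| ^ critExp N s) + 2 ^ q * |(φ : L2 N) x| ^ critExp N s := by ring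
  refine (hbase.const_mul C).congr (Eventually.of_forall fun x => ?_)
  simp only
  ring

theorem coeFn_add_smul_Hs (u φ : Hs N s) (ε : ℝ) :
    ((u + ε • φ : Hs N s) : L2 N) =ᵐ[volume] fun x => (u : L2 N) x + ε * (φ : L2 N) x := by
  filter_upwards [Lp.coeFn_add (u : L2 N) (ε • (φ : L2 N)), Lp.coeFn_smul ε (φ : L2 N)] with x h1 h2
  have : ((u + ε • φ : Hs N s) : L2 N) x = ((u : L2 N) + ε • (φ : L2 N)) x := rfl
  rw [this, h1, Pi.add_apply, h2, Pi.smul_apply, smul_eq_mul]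

/-- Differentiability of the potential in directions `φ ∈ H^s ∩ L¹`. -/
theorem hasDerivAt_potential (hN : N ≠ 0) (h0 : G0 g) (h2 : G2 N s g) (hs0 : 0 < s)
    (hs : 2 * s < N) {u φ : Hs N s} (hu : Integrable fun x => primitive g ((u : L2 N) x))
    (hφ : Integrable fun x => (φ : L2 N) x) :
    Integrable (fun x => g ((u : L2 N) x) * (φ : L2 N) x) ∧
    (∀ ε : ℝ, |ε| ≤ 1 → Integrable fun x => primitive g (((u + ε • φ : Hs N s) : L2 N) x)) ∧
    HasDerivAt (fun ε : ℝ => ∫ x, primitive g (((u + ε • φ : Hs N s) : L2 N) x))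
      (∫ x, g ((u : L2 N) x) * (φ : L2 N) x) 0 := by
  have hp := two_lt_critExp hs0 hs
  obtain ⟨C, hC, hg⟩ := h2.exists_growth h0 hs0 hs
  have henv := integrable_envelope hN hs0 hs u φ hφ C
  have hum := Lp.aestronglyMeasurable (u : L2 N)
  have hφm := Lp.aestronglyMeasurable (φ : L2 N)
  have hmeas : ∀ ε : ℝ, AEStronglyMeasurable
      (fun x => primitive g ((u : L2 N) x + ε * (φ : L2 N) x)) volume := fun ε =>
    (continuous_primitive h0).comp_aestronglyMeasurable (hum.add (hφm.const_mul ε))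
  have hgb : ∀ x, ∀ ε : ℝ, |ε| ≤ 1 → ‖g ((u : L2 N) x + ε * (φ : L2 N) x) * (φ : L2 N) x‖
      ≤ C * (1 + (|(u : L2 N) x| + |(φ : L2 N) x|) ^ (critExp N s - 1)) * |(φ : L2 N) x| := by
    intro x ε hε
    rw [norm_mul, Real.norm_eq_abs, Real.norm_eq_abs]
    refine mul_le_mul_of_nonneg_right ((hg _).trans ?_) (abs_nonneg _)
    have h3 : |(u : L2 N) x + ε * (φ : L2 N) x| ≤ |(u : L2 N) x| + |(φ : L2 N) x| := by
      refine (abs_add_le _ _).trans ?_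
      rw [abs_mul]
      have := mul_le_of_le_one_left (abs_nonneg ((φ : L2 N) x)) hε
      linarith
    have h4 := Real.rpow_le_rpow (abs_nonneg _) h3 (by linarith : 0 ≤ critExp N s - 1)
    gcongr
  have hd := hasDerivAt_integral_of_dominated_loc_of_deriv_le (𝕜 := ℝ) (μ := volume)
    (F := fun ε x => primitive g ((u : L2 N) x + ε * (φ : L2 N) x))
    (F' := fun ε x => g ((u : L2 N) x + ε * (φ : L2 N) x) * (φ : L2 N) x) (x₀ := 0)
    (s := Metric.ball 0 1) (Metric.ball_mem_nhds _ one_pos)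
    (Eventually.of_forall hmeas) (by simpa using hu)
    ((h0.1.comp_aestronglyMeasurable (hum.add (hφm.const_mul 0))).mul hφm)
    (Eventually.of_forall fun x ε hε => hgb x ε (by simpa using (Metric.mem_ball.1 hε).le))
    henv
    (Eventually.of_forall fun x ε _ => by
      have h5 : HasDerivAt (fun ε : ℝ => (u : L2 N) x + ε * (φ : L2 N) x) ((φ : L2 N) x) ε := by
        simpa using ((hasDerivAt_id ε).mul_const ((φ : L2 N) x)).const_add ((u : L2 N) x)
      exact (hasDerivAt_primitive h0 _).comp ε h5)
  have hcongr : ∀ ε : ℝ, (fun x => primitive g (((u + ε • φ : Hs N s) : L2 N) x))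
      =ᵐ[volume] fun x => primitive g ((u : L2 N) x + ε * (φ : L2 N) x) := fun ε => by
    filter_upwards [coeFn_add_smul_Hs u φ ε] with x hx
    rw [hx]
  refine ⟨by simpa using hd.1, fun ε hε => ?_, ?_⟩
  · refine Integrable.congr ?_ (hcongr ε).symm
    -- `G` has no matching lower bound, so integrability of `G(u + εφ)` is transferred from `G(u)`
    -- through the difference, which the envelope controls.
    have hdiff : Integrable fun x =>
        primitive g ((u : L2 N) x + ε * (φ : L2 N) x) - primitive g ((u : L2 N) x) := by
      refine henv.mono' ((hmeas ε).sub (aestronglyMeasurable_primitive h0 u))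
        (Eventually.of_forall fun x => ?_)
      have h3 := abs_primitive_sub_le hC (by linarith) h0 hg ((u : L2 N) x) (ε * (φ : L2 N) x)
      refine h3.trans ?_
      have h4 : |ε * (φ : L2 N) x| ≤ |(φ : L2 N) x| := by
        rw [abs_mul]
        exact mul_le_of_le_one_left (abs_nonneg _) hε
      have h5 : (|(u : L2 N) x| + |ε * (φ : L2 N) x|) ^ (critExp N s - 1)
          ≤ (|(u : L2 N) x| + |(φ : L2 N) x|) ^ (critExp N s - 1) :=
        Real.rpow_le_rpow (by positivity) (by linarith) (by linarith)
      gcongr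
    exact (hdiff.add hu).congr (Eventually.of_forall fun x => sub_add_cancel _ _)
  · have h6 : (fun ε : ℝ => ∫ x, primitive g (((u + ε • φ : Hs N s) : L2 N) x))
        = fun ε => ∫ x, primitive g ((u : L2 N) x + ε * (φ : L2 N) x) :=
      funext fun ε => integral_congr_ae (hcongr ε)
    rw [h6]
    simpa using hd.2

end Variation

/-! ### Projection by dilations and the critical-point identity -/

section Minimality

variable {N : ℕ} {s m : ℝ} {g : ℝ → ℝ} {ρ : EReal}

/-- The maximal value of the action along the dilations of a function with `∫ |(-Δ)^(s/2) v|² = a`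
and `∫ G(v) - (μ/2) ∫ v² = b > 0`. -/
def fiberMax (N : ℕ) (s a b : ℝ) : ℝ :=
  s / N * a * (a / (critExp N s * b)) ^ (((N : ℝ) - 2 * s) / (2 * s))

theorem one_half_sub_inv_critExp (hN : N ≠ 0) (hs : 2 * s < N) :
    1 / 2 - 1 / critExp N s = s / N := by
  have h1 : (N : ℝ) - 2 * s ≠ 0 := by linarith
  have h2 : (N : ℝ) ≠ 0 := by exact_mod_cast hN
  rw [critExp]
  field_simp
  ring

theorem fiberMax_of_eq {a b : ℝ} (h : a = critExp N s * b) (ha : 0 < a) :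
    fiberMax N s a b = s / N * a := by
  rw [fiberMax, ← h, div_self ha.ne', Real.one_rpow, mul_one]

/-- An envelope principle: on the constraint the maximizing dilation is the identity, so only `a/2 -
b` is differentiated. Concretely, with `θ = (N-2s)/(2s)`, one has `(s/N)(1+θ) = 1/2` and `(s/N) θ
2*_s = 1`. -/
theorem hasDerivAt_fiberMax (hN : N ≠ 0) (hs0 : 0 < s) (hs : 2 * s < N) {a b : ℝ → ℝ}
    {a' b' x : ℝ} (ha : HasDerivAt a a' x) (hb : HasDerivAt b b' x)
    (hab : a x = critExp N s * b x) (hpos : 0 < a x) :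
    HasDerivAt (fun ε => fiberMax N s (a ε) (b ε)) (a' / 2 - b') x := by
  set p := critExp N s with hp
  have hp2 : 2 < p := two_lt_critExp hs0 hs
  have hbpos : 0 < b x := by
    by_contra hcon
    nlinarith
  have hpb : p * b x ≠ 0 := by positivity
  have h1 := ha.div (hb.const_mul p) hpb
  have h2 := h1.rpow_const (p := ((N : ℝ) - 2 * s) / (2 * s)) (Or.inl (by
    simp only [Pi.div_apply]; rw [hab, div_self hpb]; exact one_ne_zero))
  have h3 := (ha.const_mul (s / N)).mul h2
  refine h3.congr_deriv ?_
  have h4 : (a / fun y => p * b y) x = 1 := by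
    simp only [Pi.div_apply]
    rw [hab, div_self hpb]
  rw [h4, Real.one_rpow, Real.one_rpow, hab]
  have e2 : (N : ℝ) ≠ 0 := by exact_mod_cast hN
  have e3 : b x ≠ 0 := hbpos.ne'
  have hd : p * ((N : ℝ) - 2 * s) = 2 * N := by
    rw [hp, critExp, div_mul_cancel₀ _ (by linarith)]
  generalize hdd : (N : ℝ) - 2 * s = d at hd ⊢
  have hp0 : p ≠ 0 := by positivity
  have e5 : s / N * a' * 1 + s / N * (p * b x) * ((a' * (p * b x) - p * b x * (p * b'))
      / (p * b x) ^ 2 * (d / (2 * s)) * 1) = ((2 * s + d) * a' - p * d * b') / (2 * N) := by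
    field_simp
    ring
  rw [e5, hd, ← hdd]
  field_simp
  ring

/-- Projecting onto the Pohožaev set along dilations. -/
theorem exists_dilate_mem_pohozaevSet (hN : N ≠ 0) (hs0 : 0 < s) (hs : 2 * s < N) {μ : ℝ}
    (hμ : ρ < (μ : EReal)) {v : Hs N s} (hv : v ≠ 0)
    (hG : Integrable fun x => primitive g ((v : L2 N) x))
    (hb : 0 < (∫ x, primitive g ((v : L2 N) x)) - μ / 2 * mass v) :
    ∃ w : Hs N s, (μ, w) ∈ pohozaevSet N s g ρ ∧
      lagrangian g m (μ, w) = ((fiberMax N s (gradSq v)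
        ((∫ x, primitive g ((v : L2 N) x)) - μ / 2 * mass v) - μ / 2 * m : ℝ) : EReal) := by
  set p := critExp N s with hp
  have hp2 : 2 < p := two_lt_critExp hs0 hs
  set V := ∫ x, primitive g ((v : L2 N) x) with hV
  set b := V - μ / 2 * mass v with hbdef
  set D := gradSq v with hD
  have hDpos : 0 < D := gradSq_pos hN hv
  -- Chosen so that `R^(2s) D = p b`, which is `P(μ, v(R·)) = 0` after removing the common factor
  -- `R^(-N)`.
  set R : ℝ := (p * b / D) ^ (2 * s)⁻¹ with hR
  have hR0 : 0 < R := by positivity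
  have hR2 : R ^ (2 * s) = p * b / D := by
    rw [hR, Real.rpow_inv_rpow (by positivity) (by positivity)]
  have hRN : 0 < (R ^ N : ℝ) := by positivity
  have hG' := integrable_comp_dilateHs hR0 v hG
  have hV' : ∫ x, primitive g ((dilateHs hR0 v : L2 N) x) = (R ^ N)⁻¹ * V :=
    integral_comp_dilateHs hR0 v _
  have hne : dilateHs hR0 v ≠ 0 := by
    intro h
    have h1 := mass_dilateHs hR0 v
    have h2 := mass_pos hv
    rw [h, mass_eq_norm_sq] at h1
    simp at h1
    rcases h1 with h1 | h1
    · exact hR0.ne' h1.1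
    · exact h2.ne' h1
  refine ⟨dilateHs hR0 v, ⟨hμ, hne, ?_⟩, ?_⟩
  · rw [pohozaev_eq μ hG', hV', gradSq_dilateHs, mass_dilateHs, hR2, ← hD, ← hp]
    norm_cast
    field_simp
    rw [hbdef]
    ring
  · rw [lagrangian_eq μ hG', hV', gradSq_dilateHs, mass_dilateHs, hR2, ← hD]
    congr 1
    have hRinv : (R ^ N)⁻¹ = (D / (p * b)) ^ (((N : ℝ) - 2 * s) / (2 * s)) * (D / (p * b)) := by
      rw [← Real.rpow_add_one (by positivity), ← Real.rpow_natCast, hR,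
        ← Real.rpow_mul (by positivity), ← Real.inv_rpow (by positivity), inv_div]
      congr 1
      field_simp
      ring
    rw [fiberMax, ← one_half_sub_inv_critExp hN hs, ← hp]
    have h5 : (R ^ N)⁻¹ * (p * b) = (D / (p * b)) ^ (((N : ℝ) - 2 * s) / (2 * s)) * D := by
      rw [hRinv]; field_simp
    have h6 : (1 / 2 - 1 / p) * D * (D / (p * b)) ^ (((N : ℝ) - 2 * s) / (2 * s))
        = (1 / 2 - 1 / p) * ((R ^ N)⁻¹ * (p * b)) := by rw [h5]; ring
    rw [h6]
    field_simp
    rw [hbdef]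
    ring

/-- Critical-point identity at a minimizer: along any differentiable admissible path, the
derivative of the maximal value along dilations vanishes. -/
theorem deriv_eq_zero_of_isMinOn (hN : N ≠ 0) (hs0 : 0 < s) (hs : 2 * s < N) {μ : ℝ} {u : Hs N s}
    (hmem : (μ, u) ∈ pohozaevSet N s g ρ)
    (hmin : IsMinOn (lagrangian g m) (pohozaevSet N s g ρ) (μ, u))
    (hu : Integrable fun x => primitive g ((u : L2 N) x))
    {ν : ℝ → ℝ} {v : ℝ → Hs N s} {x₀ ν' D' M' V' : ℝ} (hν0 : ν x₀ = μ) (hv0 : v x₀ = u)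
    (hG : ∀ᶠ ε in 𝓝 x₀, Integrable fun x => primitive g ((v ε : L2 N) x))
    (hν : HasDerivAt ν ν' x₀) (hD : HasDerivAt (fun ε => gradSq (v ε)) D' x₀)
    (hM : HasDerivAt (fun ε => mass (v ε)) M' x₀)
    (hV : HasDerivAt (fun ε => ∫ x, primitive g ((v ε : L2 N) x)) V' x₀) :
    D' / 2 - (V' - (ν' / 2 * mass u + μ / 2 * M')) - ν' / 2 * m = 0 := by
  obtain ⟨hρμ, hu0, hP⟩ := hmem
  have hp2 : 2 < critExp N s := two_lt_critExp hs0 hs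
  rw [pohozaev_eq μ hu] at hP
  have hP' : gradSq u + critExp N s *
      (μ / 2 * mass u - ∫ x, primitive g ((u : L2 N) x)) = 0 := by exact_mod_cast hP
  set b : ℝ → ℝ := fun ε => (∫ x, primitive g ((v ε : L2 N) x)) - ν ε / 2 * mass (v ε) with hbdef
  have hbderiv : HasDerivAt b (V' - (ν' / 2 * mass u + μ / 2 * M')) x₀ := by
    have := hV.sub ((hν.div_const 2).mul hM)
    rw [hν0, hv0] at this
    exact this
  have hDpos : 0 < gradSq (v x₀) := by rw [hv0]; exact gradSq_pos hN hu0
  have hab : gradSq (v x₀) = critExp N s * b x₀ := by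
    simp only [hbdef]
    rw [hv0, hν0]
    linarith
  have hbpos : 0 < b x₀ := by
    by_contra hcon
    nlinarith
  have hderiv := (hasDerivAt_fiberMax hN hs0 hs hD hbderiv hab hDpos).sub
    ((hν.div_const 2).mul_const m)
  refine IsLocalMin.hasDerivAt_eq_zero ?_ hderiv
  -- At `x₀` the path is already on the Pohožaev set, so the projected value equals the action
  -- itself.
  have hval : lagrangian g m (μ, u)
      = ((fiberMax N s (gradSq (v x₀)) (b x₀) - ν x₀ / 2 * m : ℝ) : EReal) := by
    rw [lagrangian_eq μ hu, fiberMax_of_eq hab hDpos, ← one_half_sub_inv_critExp hN hs, hv0, hν0]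
    congr 1
    have hp0 : critExp N s ≠ 0 := by linarith
    field_simp
    linarith
  -- The conditions needed for projecting are open, hence persist near `x₀`.
  have e1 : ∀ᶠ ε in 𝓝 x₀, ρ < (ν ε : EReal) :=
    (continuous_coe_real_ereal.continuousAt.comp hν.continuousAt).eventually
      (eventually_gt_nhds (by simpa [hν0] using hρμ))
  have e2 : ∀ᶠ ε in 𝓝 x₀, 0 < b ε := hbderiv.continuousAt.eventually (eventually_gt_nhds hbpos)
  have e3 : ∀ᶠ ε in 𝓝 x₀, 0 < gradSq (v ε) :=
    hD.continuousAt.eventually (eventually_gt_nhds hDpos)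
  filter_upwards [hG, e1, e2, e3] with ε h1 h2 h3 h4
  have hne : v ε ≠ 0 := by
    intro h
    rw [h] at h4
    have : gradSq (0 : Hs N s) = 0 := by
      have h7 : halfLap (0 : Hs N s) = 0 := by simpa using halfLap_smul (0 : ℝ) (0 : Hs N s)
      rw [gradSq, h7, ← norm_sq_eq_integral_sq]
      simp
    linarith
  obtain ⟨w, hw, hwval⟩ := exists_dilate_mem_pohozaevSet (m := m) hN hs0 hs h2 hne h1 h3
  have h5 : lagrangian g m (μ, u) ≤ lagrangian g m (ν ε, w) := hmin hw
  rw [hval, hwval] at h5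
  exact_mod_cast h5

end Minimality

end NormalizedSol

end

/-! ### The main theorem -/

open NormalizedSol

theorem proposition1p6 (N : ℕ) (hN : 2 ≤ N) (s : ℝ) (hs0 : 0 < s) (hs1 : s < 1)
    (m : ℝ) (hm : 0 < m) (g : ℝ → ℝ)
    (hg0 : NormalizedSol.G0 g) (hg1 : NormalizedSol.G1 g) (hg2 : NormalizedSol.G2 N s g)
    (ρ : EReal) (hρ : ρ < ⊤) (μ : ℝ) (u : NormalizedSol.Hs N s)
    (hmem : (μ, u) ∈ NormalizedSol.pohozaevSet N s g ρ)
    (hmin : IsMinOn (NormalizedSol.lagrangian g m) (NormalizedSol.pohozaevSet N s g ρ) (μ, u)) :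
    (NormalizedSol.IsWeakSolution g μ u ∧ u ∈ NormalizedSol.sphere N s m) ∧
    (NormalizedSol.lagrangian g m (μ, u) < -(ρ / 2 * (m : EReal)) →
      NormalizedSol.lagrangian g m (μ, u) = NormalizedSol.energy g u ∧
      NormalizedSol.energy g u = ⨅ v ∈ NormalizedSol.sphere N s m, NormalizedSol.energy g v) := by
  have hN0 : N ≠ 0 := by omega
  have hNr : (2 : ℝ) ≤ N := by exact_mod_cast hN
  have hs : 2 * s < N := by linarith
  have hp2 : 2 < critExp N s := two_lt_critExp hs0 hs
  have hu : Integrable fun x => primitive g ((u : L2 N) x) :=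
    integrable_primitive_of_potential hN0 hg0 hg1 hg2 hs0 hs
      (potential_ne_bot_of_pohozaev hs0 hs hmem.2.2)
  have hmass : mass u = m := by
    -- Only the multiplier moves, so the identity reduces to `mass u / 2 - m / 2 = 0`.
    have h := deriv_eq_zero_of_isMinOn hN0 hs0 hs hmem hmin hu (ν := id) (v := fun _ => u)
      (x₀ := μ) rfl rfl (Eventually.of_forall fun _ => hu) (hasDerivAt_id μ)
      (hasDerivAt_const _ _) (hasDerivAt_const _ _) (hasDerivAt_const _ _)
    linarith
  refine ⟨⟨fun φ hφ => ?_, hmass⟩, fun hlt => ?_⟩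
  · obtain ⟨hgi, hGi, hVd⟩ := hasDerivAt_potential hN0 hg0 hg2 hs0 hs hu hφ
    refine ⟨hgi, ?_⟩
    have hquad : ∀ a b c : ℝ, HasDerivAt (fun ε : ℝ => a + 2 * b * ε + c * ε ^ 2) (2 * b) 0 := by
      intro a b c
      have h := (((hasDerivAt_id (0 : ℝ)).const_mul (2 * b)).const_add a).add
        ((hasDerivAt_pow 2 (0 : ℝ)).const_mul c)
      exact h.congr_deriv (by simp)
    have hDd : HasDerivAt (fun ε : ℝ => gradSq (u + ε • φ))
        (2 * ∫ x, halfLap u x * halfLap φ x) 0 := by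
      simp_rw [gradSq_add_smul]
      exact hquad _ _ _
    have hMd : HasDerivAt (fun ε : ℝ => mass (u + ε • φ))
        (2 * ∫ x, (u : L2 N) x * (φ : L2 N) x) 0 := by
      simp_rw [mass_add_smul]
      exact hquad _ _ _
    have hnear : ∀ᶠ ε in 𝓝 (0 : ℝ),
        Integrable fun x => primitive g (((u + ε • φ : Hs N s) : L2 N) x) := by
      filter_upwards [Metric.ball_mem_nhds (0 : ℝ) one_pos] with ε hε
      exact hGi ε (by simpa using (Metric.mem_ball.1 hε).le)
    have h := deriv_eq_zero_of_isMinOn hN0 hs0 hs hmem hmin hu (ν := fun _ => μ)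
      (v := fun ε => u + ε • φ) (x₀ := 0) rfl (by simp) hnear (hasDerivAt_const _ _) hDd hMd hVd
    linarith
  · have hLK : lagrangian g m (μ, u) = energy g u := by
      rw [lagrangian_eq μ hu, energy_eq hu, hmass]
      simp
    refine ⟨hLK, le_antisymm (le_iInf₂ fun v hv => ?_) (iInf₂_le u hmass)⟩
    by_contra hcon
    rw [not_le] at hcon
    have hvm : mass v = m := hv
    -- A function with potential `-∞` has energy `+∞` and cannot undercut `u`.
    have hpot : potential g v ≠ ⊥ := by
      intro hb
      rw [energy, hb, EReal.coe_sub_bot] at hcon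
      exact not_top_lt hcon
    have hvG := integrable_primitive_of_potential hN0 hg0 hg1 hg2 hs0 hs hpot
    set V := ∫ x, primitive g ((v : L2 N) x) with hV
    have hp0 : critExp N s ≠ 0 := by linarith
    -- The multiplier solving `P(ν, v) = 0` for a function of mass `m`.
    set ν : ℝ := 2 / m * (V - gradSq v / critExp N s) with hν
    have hνm : ν / 2 * m = V - gradSq v / critExp N s := by
      rw [hν]; field_simp
    rcases lt_or_ge ρ (ν : EReal) with hlt' | hge
    · have hvmem : (ν, v) ∈ pohozaevSet N s g ρ := by
        refine ⟨hlt', ?_, ?_⟩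
        · rintro rfl
          have : mass (0 : Hs N s) = 0 := by rw [mass_eq_norm_sq]; simp
          linarith
        · rw [pohozaev_eq ν hvG, hvm, hνm, ← hV]
          norm_cast
          field_simp
          ring
      have h1 : lagrangian g m (μ, u) ≤ lagrangian g m (ν, v) := hmin hvmem
      have h2 : lagrangian g m (ν, v) = energy g v := by
        rw [lagrangian_eq ν hvG, energy_eq hvG, hvm]
        simp
      rw [h2, hLK] at h1
      exact absurd hcon (not_lt.2 h1)
    -- Here `ν ≤ ρ < ⊤`, so `ρ` is a real number; the case `ρ = -∞` cannot occur, which is why it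
    -- carries no extra condition.
    · obtain ⟨r, rfl⟩ : ∃ r : ℝ, (r : EReal) = ρ :=
        ⟨ρ.toReal, EReal.coe_toReal hρ.ne (fun h => by rw [h] at hge; simp at hge)⟩
      have hrν : ν ≤ r := by exact_mod_cast hge
      have hval : -((r : EReal) / 2 * (m : EReal)) = ((-(r / 2 * m) : ℝ) : EReal) := by
        have : (2 : EReal) = ((2 : ℝ) : EReal) := rfl
        rw [this, ← EReal.coe_div, ← EReal.coe_mul, ← EReal.coe_neg]
      have h3 := hcon.trans (hLK ▸ hlt)
      rw [energy_eq hvG, hval] at h3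
      have h4 : 1 / 2 * gradSq v - V < -(r / 2 * m) := by exact_mod_cast h3
      have h5 : ν / 2 * m ≤ r / 2 * m := by gcongr
      rw [hνm] at h5
      -- Since `2*_s > 2`, this gives `K(v) ≥ -ν m / 2 ≥ -r m / 2`, contradicting `h4`.
      have h6 : gradSq v / critExp N s ≤ 1 / 2 * gradSq v := by
        rw [div_le_iff₀ (by linarith)]
        nlinarith [gradSq_nonneg v]
      linarith
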